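/- Let $N\ge h$ be natural numbers and let $X_i=\sum_{j=1}^N\sigma_{ij}(x)\,\partial_{x_j}$, $i=1,\dots,h$, be vector fields with $\sigma_{ij}\in C^1(\mathbb R^N\setminus\{0\})$. Put $\nabla_{\mathcal L}u=(X_1u,\dots,X_hu)$, let $X_i^*f=-\sum_j\partial_{x_j}(\sigma_{ij}f)$ be the formal adjoint of $X_i$, and put $\mathcal L_pu=-\sum_{i=1}^hX_i^*\big(|\nabla_{\mathcal L}u|^{p-2}X_iu\big)$. Let $d:\mathbb R^N\setminus\{0\}\to(0,\infty)$ be smooth with $\nabla_{\mathcal L}d\ne0$ almost everywhere in $\mathbb R^N$ and $\nabla d\neq 0$ on $\{d=r\}$ for a.e. $r>0$. Let $p\ge2$ and $\beta\in\mathbb R$ be such that $$\mathcal L_pd=\frac{(1-\beta)(p-1)|\nabla_{\mathcal L}d|^p}{d}\qquad\text{in }\mathbb R^N\setminus\{0\}.$$ For $\theta\in\mathbb R$ put $\alpha=\frac{p(\theta-1)+\beta(p-1)}{p}$ and $$M(u)=\int_{\mathbb R^N}\frac{|u|^p}{d^{p\theta}}|\nabla_{\mathcal L}d|^p\,dx,\qquad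 R(u)=\int_{\mathbb R^N}\frac{|\nabla_{\mathcal L}u\cdot\nabla_{\mathcal L}d|^p}{d^{p(\theta-1)}}\frac1{|\nabla_{\mathcal L}d|^p}\,dx,\qquad G(u)=\int_{\mathbb R^N}\frac{|\nabla_{\mathcal L}u|^p}{d^{p(\theta-1)}}\,dx .$$ **(i) Inequality.** For every $\theta\in\mathbb R$ and every real-valued $u\in C_c^\infty(\mathbb R^N\setminus\{0\})$ the three integrals converge, and $$|\alpha|^p\,M(u)\;\le\;R(u)\;\le\;G(u).\tag{1}$$ **(ii) Sharpness and extremals.** Suppose in addition that for some constant $\gamma_p>0$ $$\int_{\{d=r\}}\frac{|\nabla_{\mathcal L}d|^p}{|\nabla d|}\,d\mathcal H_{N-1}=\gamma_p\,r^{(p-1)(1-\beta)}\qquad\text{for a.e. }r>0,$$ and that $\{x\ne0:\ a\le d(x)\le b\}$ is compact for all $0<a\le b<\infty$. Then for every $\theta\in\mathbb R$ the constant in (1) is sharp: $$|\alpha|^p=\inf_{u}\frac{R(u)}{M(u)}=\inf_{u}\frac{G(u)}{M(u)},$$ both infima being over $0\neq u\in C_c^\infty(\mathbb R^N\setminus\{0\})$.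 No nonzero $u\in C_c^\infty(\mathbb R^N\setminus\{0\})$ satisfies $|\alpha|^pM(u)=R(u)=G(u)$. Say that $u\in C^1(\mathbb R^N\setminus\{0\})$ (not necessarily admissible in (1)) *achieves both equalities* if there are $u_n\in C_c^\infty(\mathbb R^N\setminus\{0\})$ with $u_n\to u$ and $\nabla u_n\to\nabla u$ locally uniformly in $\mathbb R^N\setminus\{0\}$, $R(u_n)-|\alpha|^pM(u_n)\to0$ and $G(u_n)-R(u_n)\to0$. Then: * $c\,d^{\alpha}$ achieves both equalities, for every $c\in\mathbb R$. * If $u$ achieves both equalities, then $\nabla_{\mathcal L}(d^{-\alpha}u)=0$ in $\mathbb R^N\setminus\{0\}$. Moreover $u=c\,d^{\alpha}$ in $\mathbb R^N\setminus\{0\}$ for some constant $c\in\mathbb R$ as soon as $u$ is $d$-radial (that is, $u=\varphi\circ d$ for some function $\varphi$), or the only functions $v\in C^1(\mathbb R^N\setminus\{0\})$ with $\nabla_{\mathcal L}v=0$ are the constants. -/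

import Mathlib

open Filter Topology MeasureTheory Set
open scoped ContDiff Gradient

/-- Euclidean space `ℝ^N`. -/
abbrev EucN (N : ℕ) : Type := EuclideanSpace ℝ (Fin N)

/-- The vector field `X_i = ∑_j σ_{ij} ∂/∂x_j` applied to a function `u`. -/
noncomputable def vectorField {N h : ℕ} (σ : EucN N → Matrix (Fin h) (Fin N) ℝ) (i : Fin h)
    (u : EucN N → ℝ) (x : EucN N) : ℝ :=
  ∑ j, σ x i j * fderiv ℝ u x (EuclideanSpace.single j 1)

/-- The formal adjoint `X_i^* f = - ∑_j ∂/∂x_j (σ_{ij} f)`. -/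
noncomputable def formalAdjoint {N h : ℕ} (σ : EucN N → Matrix (Fin h) (Fin N) ℝ) (i : Fin h)
    (f : EucN N → ℝ) (x : EucN N) : ℝ :=
  -∑ j, fderiv ℝ (fun y => σ y i j * f y) x (EuclideanSpace.single j 1)

/-- The gradient `∇_L u = (X_1 u, …, X_h u)`, with values in Euclidean `ℝ^h`. -/
noncomputable def gradL {N h : ℕ} (σ : EucN N → Matrix (Fin h) (Fin N) ℝ)
    (u : EucN N → ℝ) (x : EucN N) : EucN h :=
  WithLp.toLp 2 (fun i => vectorField σ i u x)

/-- The operator `L_p u = - ∇_L^* · (|∇_L u|^{p-2} ∇_L u)`. -/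
noncomputable def opLp {N h : ℕ} (σ : EucN N → Matrix (Fin h) (Fin N) ℝ) (p : ℝ)
    (u : EucN N → ℝ) (x : EucN N) : ℝ :=
  -∑ i, formalAdjoint σ i (fun y => ‖gradL σ u y‖ ^ (p - 2) * vectorField σ i u y) x

/-- `u ∈ C_c^∞(ℝ^N \ {0})`. -/
def IsTest {N : ℕ} (u : EucN N → ℝ) : Prop :=
  ContDiff ℝ ∞ u ∧ HasCompactSupport u ∧ tsupport u ⊆ {0}ᶜ

/-- The integrand `|u|^p d^{-pθ} |∇_L d|^p`. -/
noncomputable def massDensity {N h : ℕ} (σ : EucN N → Matrix (Fin h) (Fin N) ℝ)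
    (d : EucN N → ℝ) (p θ : ℝ) (u : EucN N → ℝ) (x : EucN N) : ℝ :=
  |u x| ^ p / d x ^ (p * θ) * ‖gradL σ d x‖ ^ p

/-- The integrand `|∇_L u · ∇_L d|^p d^{-p(θ-1)} |∇_L d|^{-p}`. -/
noncomputable def radialDensity {N h : ℕ} (σ : EucN N → Matrix (Fin h) (Fin N) ℝ)
    (d : EucN N → ℝ) (p θ : ℝ) (u : EucN N → ℝ) (x : EucN N) : ℝ :=
  |inner ℝ (gradL σ u x) (gradL σ d x)| ^ p / d x ^ (p * (θ - 1)) * (1 / ‖gradL σ d x‖ ^ p)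

/-- The integrand `|∇_L u|^p d^{-p(θ-1)}`. -/
noncomputable def gradientDensity {N h : ℕ} (σ : EucN N → Matrix (Fin h) (Fin N) ℝ)
    (d : EucN N → ℝ) (p θ : ℝ) (u : EucN N → ℝ) (x : EucN N) : ℝ :=
  ‖gradL σ u x‖ ^ p / d x ^ (p * (θ - 1))

/-- The weighted mass, left-hand integral of the Hardy inequality. -/
noncomputable def massInt {N h : ℕ} (σ : EucN N → Matrix (Fin h) (Fin N) ℝ)
    (d : EucN N → ℝ) (p θ : ℝ) (u : EucN N → ℝ) : ℝ :=
  ∫ x, massDensity σ d p θ u x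

/-- The radial energy, middle integral of the Hardy inequality. -/
noncomputable def radialInt {N h : ℕ} (σ : EucN N → Matrix (Fin h) (Fin N) ℝ)
    (d : EucN N → ℝ) (p θ : ℝ) (u : EucN N → ℝ) : ℝ :=
  ∫ x, radialDensity σ d p θ u x

/-- The full energy, right-hand integral of the Hardy inequality. -/
noncomputable def gradientInt {N h : ℕ} (σ : EucN N → Matrix (Fin h) (Fin N) ℝ)
    (d : EucN N → ℝ) (p θ : ℝ) (u : EucN N → ℝ) : ℝ :=
  ∫ x, gradientDensity σ d p θ u x

/-- The exponent `α = (p(θ-1) + β(p-1)) / p`. -/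
noncomputable def hardyExp (p β θ : ℝ) : ℝ := (p * (θ - 1) + β * (p - 1)) / p

/-- A possibly non-admissible function `u ∈ C^1(ℝ^N \ {0})` achieves both equalities in
`|α|^p · mass ≤ radial energy ≤ full energy`: it is a limit, in `C^1_loc(ℝ^N \ {0})`, of admissible
functions along which the two differences of consecutive members tend to zero.
(The integrals of such a `u` itself may be infinite.) -/
def AchievesBoth {N h : ℕ} (σ : EucN N → Matrix (Fin h) (Fin N) ℝ)
    (d : EucN N → ℝ) (p β θ : ℝ) (u : EucN N → ℝ) : Prop :=
  ContDiffOn ℝ 1 u {0}ᶜ ∧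
  ∃ U : ℕ → EucN N → ℝ, (∀ n, IsTest (U n)) ∧
    TendstoLocallyUniformlyOn U u atTop {0}ᶜ ∧
    TendstoLocallyUniformlyOn (fun n => fderiv ℝ (U n)) (fderiv ℝ u) atTop {0}ᶜ ∧
    Tendsto (fun n => radialInt σ d p θ (U n) - |hardyExp p β θ| ^ p * massInt σ d p θ (U n))
      atTop (𝓝 0) ∧
    Tendsto (fun n => gradientInt σ d p θ (U n) - radialInt σ d p θ (U n)) atTop (𝓝 0)

/-! Put `κ = (p - 1)(1 - β)`. The equation for `d` says that the field `d ^ (-κ) ‖∇_L d‖ ^ (p - 2)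
∇_L d` is divergence free for `∇_L` (`integral_flux_eq_zero`), and everything comes from testing
this field.

Inequality: testing against `|u| ^ p d ^ (-pα)`, with `pα = pθ - 1 - κ`, gives `∫ crossDensity = α
M(u)` (`integral_crossDensity`). Put `a = α u d ^ (-θ) ‖∇_L d‖` and let `b` be `d ^ (1 - θ)` times
the component of `∇_L u` along `∇_L d`. Then `|b| ^ p` lies above the tangent line of `|t| ^ p` at
`a`, and the linear term integrates to zero. So `R - |α| ^ p M` is the integral of a nonnegative gap
(`integral_tangentGap`), while `R ≤ G` is Cauchy–Schwarz.

Rigidity: if both differences tend to zero, Fatou makes both pointwise gaps vanish in the limit.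
Strict convexity and equality in Cauchy–Schwarz then give `∇_L u = (α u / d) ∇_L d`, that is, `∇_L
(d ^ (-α) u) = 0`.

Sharpness: testing against `η(log d)` shows that `g ↦ ∫ g(log d) logWeight` kills every derivative
`η'`, hence is a multiple of `∫ g` (`exists_integral_log_eq`). For `u = d ^ α ψ(log d / r)` the
energies become integrals on the line, with `R = G = C r ∫ |α ψ + ψ' / r| ^ p` and `M = C r ∫ |ψ| ^
p`. Since `s ↦ ∫ |α ψ + s ψ'| ^ p` is stationary at `0`, not only `R / M → |α| ^ p` but also `R -
|α| ^ p M → 0` as `r → ∞`; this makes `c d ^ α` a generalized extremal. -/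

/-! ### Powers of norms, convexity of `|t| ^ p`, and energies on the line. -/

/-- The power `‖w‖ ^ q` alone may fail to be differentiable at `0`; the factor `ℓ w` makes the
product `o(‖w‖)` there. It also kills the term with `‖x‖ ^ (q - 2)` at `x = 0`, so one formula
covers all points. -/
theorem hasFDerivAt_norm_rpow_mul {E : Type*} [NormedAddCommGroup E] [InnerProductSpace ℝ E]
    {q : ℝ} (hq : 0 < q) (ℓ : E →L[ℝ] ℝ) (x : E) :
    HasFDerivAt (fun w : E => ‖w‖ ^ q * ℓ w)
      (‖x‖ ^ q • ℓ + (ℓ x * (q * ‖x‖ ^ (q - 2))) • innerSL ℝ x) x := by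
  by_cases hx : x = 0
  · subst hx
    simp only [norm_zero, Real.zero_rpow hq.ne', zero_smul, map_zero, zero_mul, zero_add]
    refine .of_isLittleO ?_
    simp only [map_zero, mul_zero, sub_zero, zero_apply]
    have h1 : (fun w : E => ‖w‖ ^ q) =o[𝓝 0] (fun _ => (1 : ℝ)) := by
      refine (Asymptotics.isLittleO_const_iff one_ne_zero).2 ?_
      have : ContinuousAt (fun w : E => ‖w‖ ^ q) 0 :=
        continuousAt_id.norm.rpow_const (.inr hq.le)
      simpa [ContinuousAt, Real.zero_rpow hq.ne'] using this
    have h2 := h1.mul_isBigO (ℓ.isBigO_id (𝓝 0)).norm_right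
    refine h2.trans_isBigO ?_
    simp_rw [one_mul]
    exact (Asymptotics.isBigO_refl _ _).norm_left
  · have h1 : HasFDerivAt (fun w : E => ‖w‖ ^ q) ((q * ‖x‖ ^ (q - 2)) • innerSL ℝ x) x := by
      apply HasStrictFDerivAt.hasFDerivAt
      convert! (hasStrictFDerivAt_norm_sq x).rpow_const (p := q / 2) (by simp [hx]) using 0
      simp_rw [← Real.rpow_natCast_mul (norm_nonneg _), ← Nat.cast_smul_eq_nsmul ℝ, smul_smul]
      ring_nf
    have h2 := h1.mul ℓ.hasFDerivAt
    refine h2.congr_fderiv ?_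
    rw [smul_smul]

/-- The map `w ↦ ‖w‖ ^ q ℓ(w)` is continuously differentiable for `q ≥ 0`. -/
theorem contDiff_norm_rpow_mul {E : Type*} [NormedAddCommGroup E] [InnerProductSpace ℝ E]
    {q : ℝ} (hq : 0 ≤ q) (ℓ : E →L[ℝ] ℝ) :
    ContDiff ℝ 1 (fun w : E => ‖w‖ ^ q * ℓ w) := by
  rcases hq.eq_or_lt with rfl | hq
  · simpa using ℓ.contDiff
  refine contDiff_one_iff_hasFDerivAt.2 ⟨_, ?_, hasFDerivAt_norm_rpow_mul hq ℓ⟩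
  have hn : Continuous fun w : E => ‖w‖ ^ q :=
    continuous_norm.rpow_const fun _ => .inr hq.le
  refine (hn.smul continuous_const).add (continuous_iff_continuousAt.2 fun x => ?_)
  by_cases hx : x = 0
  · subst hx
    simp only [ContinuousAt, map_zero, smul_zero]
    refine squeeze_zero_norm (a := fun w : E => ‖ℓ‖ * q * ‖w‖ ^ q) (fun w => ?_) ?_
    · rcases eq_or_ne w 0 with rfl | hw
      · simp [Real.zero_rpow hq.ne']
      have hw' : 0 < ‖w‖ := norm_pos_iff.2 hw
      rw [norm_smul, innerSL_apply_norm, norm_mul, Real.norm_eq_abs (q * _),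
        abs_of_nonneg (by positivity)]
      calc ‖ℓ w‖ * (q * ‖w‖ ^ (q - 2)) * ‖w‖
          ≤ ‖ℓ‖ * ‖w‖ * (q * ‖w‖ ^ (q - 2)) * ‖w‖ := by
            gcongr; exact ℓ.le_opNorm w
        _ = ‖ℓ‖ * q * (‖w‖ ^ (q - 2) * ‖w‖ ^ (2 : ℝ)) := by
            rw [Real.rpow_two]; ring
        _ = ‖ℓ‖ * q * ‖w‖ ^ q := by rw [← Real.rpow_add hw']; ring_nf
    · have := (hn.tendsto 0).const_mul (‖ℓ‖ * q)
      simpa [Real.zero_rpow hq.ne'] using this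
  · have h1 : ContinuousAt (fun w : E => ‖w‖ ^ (q - 2)) x :=
      continuousAt_id.norm.rpow_const (.inl (by simpa using hx))
    exact (ℓ.continuous.continuousAt.mul (continuousAt_const.mul h1)).smul
      (innerSL ℝ).continuous.continuousAt

/-- A function that vanishes off a compact subset of `U` and is smooth in `U` is a test function
of `U`. -/
theorem ContDiffOn.contDiff_of_support_subset {E F : Type*} [NormedAddCommGroup E]
    [NormedSpace ℝ E] [NormedAddCommGroup F] [NormedSpace ℝ F] {n : WithTop ℕ∞} {f : E → F}
    {U K : Set E} (hf : ContDiffOn ℝ n f U) (hU : IsOpen U) (hK : IsCompact K) (hKU : K ⊆ U)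
    (hs : ∀ x, x ∉ K → f x = 0) :
    ContDiff ℝ n f ∧ HasCompactSupport f ∧ tsupport f ⊆ U := by
  have h1 : tsupport f ⊆ K :=
    closure_minimal (fun x hx => by_contra fun h => hx (hs x h)) hK.isClosed
  refine ⟨contDiff_iff_contDiffAt.2 fun x => ?_, HasCompactSupport.intro hK hs, h1.trans hKU⟩
  by_cases hx : x ∈ tsupport f
  · exact hf.contDiffAt (hU.mem_nhds (hKU (h1 hx)))
  · exact contDiffAt_const.congr_of_eventuallyEq (notMem_tsupport_iff_eventuallyEq.1 hx)

theorem ContinuousOn.continuous_of_support_subset {E F : Type*} [TopologicalSpace E] [T2Space E]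
    [TopologicalSpace F] [Zero F] {f : E → F}
    {U K : Set E} (hf : ContinuousOn f U) (hU : IsOpen U) (hK : IsCompact K) (hKU : K ⊆ U)
    (hs : ∀ x, x ∉ K → f x = 0) :
    Continuous f ∧ HasCompactSupport f := by
  have h1 : tsupport f ⊆ K :=
    closure_minimal (fun x hx => by_contra fun h => hx (hs x h)) hK.isClosed
  exact ⟨continuous_of_tsupport fun x hx => hf.continuousAt (hU.mem_nhds (hKU (h1 hx))),
    HasCompactSupport.intro hK hs⟩

/-- By homogeneity `b = t a` reduces this to Bernoulli's inequality for `t`. For `t < 0` Bernoulli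
is applied to `|t|`, and strictness comes from `t < |t|`. -/
theorem abs_rpow_tangent_lt {p : ℝ} (hp : 2 ≤ p) {a b : ℝ} (hab : a ≠ b) :
    0 < |b| ^ p - |a| ^ p - p * (|a| ^ (p - 2) * a) * (b - a) := by
  have hp1 : 1 < p := by linarith
  rcases eq_or_ne a 0 with rfl | ha
  · have hb : 0 < |b| := abs_pos.2 hab.symm
    have : (0 : ℝ) ^ p = 0 := Real.zero_rpow (by linarith)
    simp [this]
    positivity
  have ha' : 0 < |a| := abs_pos.2 ha
  obtain ⟨t, rfl⟩ : ∃ t, b = t * a := ⟨b / a, by field_simp⟩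
  have ht : t ≠ 1 := fun h => hab (by rw [h, one_mul])
  have key : 1 + p * (t - 1) < |t| ^ p := by
    rcases le_or_gt 0 t with h0 | h0
    · have := one_add_mul_self_lt_rpow_one_add (s := t - 1) (by linarith)
        (sub_ne_zero.2 ht) hp1
      rw [abs_of_nonneg h0]
      simpa using this
    · have := one_add_mul_self_le_rpow_one_add (s := |t| - 1)
        (by linarith [abs_nonneg t]) hp1.le
      have h2 : p * (t - 1) < p * (|t| - 1) := by
        apply mul_lt_mul_of_pos_left _ (by linarith)
        linarith [abs_pos.2 h0.ne]
      have h3 : (1 + (|t| - 1)) = |t| := by ring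
      rw [h3] at this
      linarith
  have e : |a| ^ (p - 2) * a * a = |a| ^ p := by
    rw [mul_assoc, ← abs_mul_abs_self a, ← pow_two, ← Real.rpow_natCast, ← Real.rpow_add ha']
    norm_num
  have hpos : 0 < |a| ^ p := by positivity
  rw [abs_mul, Real.mul_rpow (abs_nonneg _) (abs_nonneg _)]
  have : |t| ^ p * |a| ^ p - |a| ^ p - p * (|a| ^ (p - 2) * a) * (t * a - a)
      = |a| ^ p * (|t| ^ p - (1 + p * (t - 1))) := by
    rw [← e]; ring
  rw [this]
  exact mul_pos hpos (by linarith)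

theorem abs_rpow_tangent_le {p : ℝ} (hp : 2 ≤ p) (a b : ℝ) :
    0 ≤ |b| ^ p - |a| ^ p - p * (|a| ^ (p - 2) * a) * (b - a) := by
  rcases eq_or_ne a b with rfl | h
  · simp
  · exact (abs_rpow_tangent_lt hp h).le

/-- The primitive based to the left of the support vanishes on the left trivially, and on the right
because the total integral is zero. -/
theorem exists_primitive_of_integral_eq_zero {g : ℝ → ℝ} (hg : Continuous g)
    (hc : HasCompactSupport g) (h0 : ∫ t, g t = 0) :
    ∃ η : ℝ → ℝ, ContDiff ℝ 1 η ∧ HasCompactSupport η ∧ ∀ t, HasDerivAt η (g t) t := by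
  obtain ⟨R, hR⟩ : ∃ R : ℝ, ∀ t, R < |t| → g t = 0 := by
    obtain ⟨R, hR⟩ := hc.isCompact.isBounded.subset_closedBall 0
    refine ⟨R, fun t ht => image_eq_zero_of_notMem_tsupport fun h => ?_⟩
    have := hR h
    rw [mem_closedBall_zero_iff, Real.norm_eq_abs] at this
    linarith
  have hd : ∀ t, HasDerivAt (fun t => ∫ s in (-|R| - 1)..t, g s) (g t) t := fun t =>
    intervalIntegral.integral_hasDerivAt_right (hg.intervalIntegrable _ _)
      hg.stronglyMeasurable.stronglyMeasurableAtFilter hg.continuousAt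
  refine ⟨_, contDiff_one_iff_deriv.2 ⟨fun t => (hd t).differentiableAt, ?_⟩, ?_, hd⟩
  · rw [funext fun t => (hd t).deriv]; exact hg
  · refine HasCompactSupport.intro (isCompact_Icc (a := -|R| - 1) (b := |R| + 1)) fun t ht => ?_
    simp only [mem_Icc, not_and_or, not_le] at ht
    have hRa := le_abs_self R
    rcases ht with ht | ht
    · rw [intervalIntegral.integral_symm, intervalIntegral.integral_of_le ht.le,
        setIntegral_eq_zero_of_forall_eq_zero, neg_zero]
      intro s hs
      refine hR s (lt_of_lt_of_le ?_ (neg_le_abs s))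
      linarith [hs.2]
    · rw [intervalIntegral.integral_of_le (by linarith [abs_nonneg R]),
        setIntegral_eq_integral_of_forall_compl_eq_zero, h0]
      intro s hs
      rw [mem_Ioc, not_and_or, not_lt, not_le] at hs
      refine hR s ?_
      rcases hs with hs | hs
      · exact lt_of_lt_of_le (by linarith) (neg_le_abs s)
      · exact lt_of_lt_of_le (by linarith) (le_abs_self s)

/-- A pointwise limit of nonnegative functions whose integrals tend to zero vanishes. -/
theorem ae_eq_zero_of_tendsto_integral_zero {X : Type*} [MeasurableSpace X] {μ : Measure X}
    {F : ℕ → X → ℝ} {f : X → ℝ} (hF : ∀ n, Integrable (F n) μ) (h0 : ∀ n, ∀ᵐ x ∂μ, 0 ≤ F n x)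
    (hlim : ∀ᵐ x ∂μ, Tendsto (fun n => F n x) atTop (𝓝 (f x)))
    (hint : Tendsto (fun n => ∫ x, F n x ∂μ) atTop (𝓝 0)) :
    ∀ᵐ x ∂μ, f x = 0 := by
  -- Fatou's lemma, with right-hand side the limit of the integrals, which is zero.
  have h1 : ∫⁻ x, liminf (fun n => ENNReal.ofReal (F n x)) atTop ∂μ = 0 := by
    refine le_antisymm ((lintegral_liminf_le' fun n =>
      (hF n).aestronglyMeasurable.aemeasurable.ennreal_ofReal).trans ?_) zero_le
    have : Tendsto (fun n => ∫⁻ x, ENNReal.ofReal (F n x) ∂μ) atTop (𝓝 0) := by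
      have := ENNReal.tendsto_ofReal hint
      simp_rw [ofReal_integral_eq_lintegral_ofReal (hF _) (h0 _)] at this
      simpa using this
    exact this.liminf_eq.le
  have hf : ∀ᵐ x ∂μ, 0 ≤ f x := by
    filter_upwards [ae_all_iff.2 h0, hlim] with x hx hl
    exact ge_of_tendsto' hl hx
  rw [lintegral_eq_zero_iff'] at h1
  · filter_upwards [h1, hlim, hf] with x hx hl hf
    have hx := ((ENNReal.continuous_ofReal.tendsto _).comp hl).liminf_eq.symm.trans hx
    exact le_antisymm (ENNReal.ofReal_eq_zero.1 hx) hf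
  · have hm : AEMeasurable f μ :=
      aemeasurable_of_tendsto_metrizable_ae atTop
        (fun n => (hF n).aestronglyMeasurable.aemeasurable) hlim
    refine hm.ennreal_ofReal.congr ?_
    filter_upwards [hlim] with x hl
    exact ((ENNReal.continuous_ofReal.tendsto _).comp hl).liminf_eq.symm

/-- The energy `s ↦ ∫ |a ψ + s ψ'| ^ p` is stationary at `s = 0`. -/
theorem hasDerivAt_integral_abs_rpow {p : ℝ} (hp : 2 ≤ p) (a : ℝ) {ψ : ℝ → ℝ}
    (hψ : ContDiff ℝ 1 ψ) (hc : HasCompactSupport ψ) :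
    HasDerivAt (fun s : ℝ => ∫ t, |a * ψ t + s * deriv ψ t| ^ p) 0 0 := by
  have hp1 : 1 < p := by linarith
  have hp0 : 0 ≤ p := by linarith
  have hψ0 := hψ.continuous
  have hψ1 : Continuous (deriv ψ) := hψ.continuous_deriv le_rfl
  have hc1 : HasCompactSupport (deriv ψ) := hc.deriv
  have hcont : ∀ s : ℝ, Continuous fun t => |a * ψ t + s * deriv ψ t| ^ p := fun s =>
    (by fun_prop : Continuous fun t => |a * ψ t + s * deriv ψ t|).rpow_const fun _ => .inr hp0
  have hzero : ∀ t, t ∉ tsupport ψ → ψ t = 0 ∧ deriv ψ t = 0 := fun t ht =>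
    ⟨image_eq_zero_of_notMem_tsupport ht,
      Function.notMem_support.1 fun h => ht (support_deriv_subset h)⟩
  have hint : ∀ s : ℝ, Integrable fun t => |a * ψ t + s * deriv ψ t| ^ p := fun s =>
    (hcont s).integrable_of_hasCompactSupport <| HasCompactSupport.intro hc fun t ht => by
      simp [hzero t ht, Real.zero_rpow (by linarith : p ≠ 0)]
  have hbc : Continuous fun t => p * (|a * ψ t| + |deriv ψ t|) ^ (p - 1) * |deriv ψ t| :=
    (continuous_const.mul ((by fun_prop : Continuous fun t => |a * ψ t| + |deriv ψ t|).rpow_const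
      fun _ => .inr (by linarith))).mul hψ1.abs
  -- For `|s| < 1` one has `|a ψ + s ψ'| ≤ |a ψ| + |ψ'|`, which yields a dominating function
  -- independent of `s` and supported in the support of `ψ'`.
  have key := hasDerivAt_integral_of_dominated_loc_of_deriv_le (μ := volume)
    (F := fun s t => |a * ψ t + s * deriv ψ t| ^ p)
    (F' := fun s t => p * |a * ψ t + s * deriv ψ t| ^ (p - 2) * (a * ψ t + s * deriv ψ t)
      * deriv ψ t) (x₀ := (0 : ℝ)) (s := Metric.ball 0 1)
    (bound := fun t => p * (|a * ψ t| + |deriv ψ t|) ^ (p - 1) * |deriv ψ t|)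
    (Metric.ball_mem_nhds _ one_pos)
    (Eventually.of_forall fun s => (hcont s).aestronglyMeasurable) (hint 0) ?_ ?_ ?_ ?_
  · refine key.2.congr_deriv ?_
    -- At `s = 0` the integrand of the derivative is exact: it is the derivative of the compactly
    -- supported function `|a| ^ (p - 2) a |ψ| ^ p`.
    have h1 : ∀ t, HasDerivAt (fun t => |a| ^ (p - 2) * a * |ψ t| ^ p)
        (|a| ^ (p - 2) * a * (p * |ψ t| ^ (p - 2) * ψ t * deriv ψ t)) t := fun t =>
      (((hasDerivAt_abs_rpow (ψ t) hp1).comp t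
        (hψ.differentiable one_ne_zero t).hasDerivAt)).const_mul _
    have h2 : ∀ t, p * |a * ψ t + 0 * deriv ψ t| ^ (p - 2) * (a * ψ t + 0 * deriv ψ t) * deriv ψ t
        = |a| ^ (p - 2) * a * (p * |ψ t| ^ (p - 2) * ψ t * deriv ψ t) := fun t => by
      rw [zero_mul, add_zero, abs_mul, Real.mul_rpow (abs_nonneg _) (abs_nonneg _)]; ring
    rw [integral_congr_ae (Eventually.of_forall h2)]
    refine integral_eq_zero_of_hasDerivAt_of_integrable h1 ?_ ?_
    · refine Continuous.integrable_of_hasCompactSupport ?_ (HasCompactSupport.intro hc1 fun t ht => ?_)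
      · have : Continuous fun t => |ψ t| ^ (p - 2) :=
          hψ0.abs.rpow_const fun _ => .inr (by linarith)
        fun_prop
      · simp [image_eq_zero_of_notMem_tsupport ht]
    · refine Continuous.integrable_of_hasCompactSupport ?_ (HasCompactSupport.intro hc fun t ht => ?_)
      · exact continuous_const.mul (hψ0.abs.rpow_const fun _ => .inr hp0)
      · simp [image_eq_zero_of_notMem_tsupport ht, Real.zero_rpow (by linarith : p ≠ 0)]
  · have : Continuous fun t => |a * ψ t + 0 * deriv ψ t| ^ (p - 2) :=
      (by fun_prop : Continuous fun t => |a * ψ t + 0 * deriv ψ t|).rpow_const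
        fun _ => .inr (by linarith)
    exact (by fun_prop : Continuous _).aestronglyMeasurable
  · refine Eventually.of_forall fun t s hs => ?_
    rw [mem_ball_zero_iff, Real.norm_eq_abs] at hs
    set y := a * ψ t + s * deriv ψ t with hy
    have hyb : |y| ≤ |a * ψ t| + |deriv ψ t| := by
      refine (abs_add_le _ _).trans (add_le_add le_rfl ?_)
      rw [abs_mul]
      exact mul_le_of_le_one_left (abs_nonneg _) hs.le
    rw [Real.norm_eq_abs, abs_mul, abs_mul, abs_mul, abs_of_nonneg hp0,
      abs_of_nonneg (Real.rpow_nonneg (abs_nonneg y) _)]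
    refine mul_le_mul_of_nonneg_right ?_ (abs_nonneg _)
    rw [mul_assoc]
    refine mul_le_mul_of_nonneg_left ?_ hp0
    have : |y| ^ (p - 2) * |y| = |y| ^ (p - 1) := by
      rw [← Real.rpow_add_one' (abs_nonneg _) (by linarith)]; ring_nf
    rw [this]
    exact Real.rpow_le_rpow (abs_nonneg _) hyb (by linarith)
  · exact hbc.integrable_of_hasCompactSupport (HasCompactSupport.intro hc1 fun t ht => by
      simp [image_eq_zero_of_notMem_tsupport ht])
  · refine Eventually.of_forall fun t s _ => ?_
    have h1 : HasDerivAt (fun s : ℝ => a * ψ t + s * deriv ψ t) (deriv ψ t) s := by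
      simpa using ((hasDerivAt_id s).mul_const (deriv ψ t)).const_add (a * ψ t)
    exact (hasDerivAt_abs_rpow _ hp1).comp s h1

/-! ### The gradient `∇_L` and integration by parts. -/

section Gradient

variable {N h : ℕ} {σ : EucN N → Matrix (Fin h) (Fin N) ℝ}

/-- The two-term form of the derivative lets this serve as product rule and chain rule at once for
all the functions built from `u` and `d`. -/
theorem vectorField_of_hasFDerivAt {i : Fin h} {u v w : EucN N → ℝ} {x : EucN N} {a b : ℝ}
    (hu : HasFDerivAt u (a • fderiv ℝ v x + b • fderiv ℝ w x) x) :
    vectorField σ i u x = a * vectorField σ i v x + b * vectorField σ i w x := by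
  simp only [vectorField, hu.fderiv, add_apply, smul_apply, smul_eq_mul, Finset.mul_sum,
    ← Finset.sum_add_distrib]
  exact Finset.sum_congr rfl fun j _ => by ring

theorem gradL_of_hasFDerivAt {u v w : EucN N → ℝ} {x : EucN N} {a b : ℝ}
    (hu : HasFDerivAt u (a • fderiv ℝ v x + b • fderiv ℝ w x) x) :
    gradL σ u x = a • gradL σ v x + b • gradL σ w x := by
  ext i
  simpa [gradL] using vectorField_of_hasFDerivAt (i := i) hu

theorem gradL_eq_zero_of_fderiv {u : EucN N → ℝ} {x : EucN N} (hu : fderiv ℝ u x = 0) :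
    gradL σ u x = 0 := by
  ext i
  simp [gradL, vectorField, hu]

theorem gradL_congr {u v : EucN N → ℝ} {x : EucN N} (huv : u =ᶠ[𝓝 x] v) :
    gradL σ u x = gradL σ v x := by
  simp only [gradL, vectorField, huv.fderiv_eq]

theorem inner_gradL (u v : EucN N → ℝ) (x : EucN N) :
    inner ℝ (gradL σ u x) (gradL σ v x) = ∑ i, vectorField σ i u x * vectorField σ i v x := by
  simp [gradL, PiLp.inner_apply, mul_comm]

theorem fderiv_eq_zero_of_support_subset {K : Set (EucN N)} {u : EucN N → ℝ} (hK : IsCompact K)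
    (hs : ∀ x, x ∉ K → u x = 0) {x : EucN N} (hx : x ∉ K) : fderiv ℝ u x = 0 := by
  have : u =ᶠ[𝓝 x] fun _ => 0 := by
    filter_upwards [hK.isClosed.isOpen_compl.mem_nhds hx] with y hy using hs y hy
  rw [this.fderiv_eq, fderiv_fun_const]; rfl

theorem continuousOn_vectorField (hσ : ∀ i j, ContDiffOn ℝ 1 (fun x => σ x i j) {0}ᶜ)
    {u : EucN N → ℝ} (hu : ContDiffOn ℝ 1 u {0}ᶜ) (i : Fin h) :
    ContinuousOn (vectorField σ i u) {0}ᶜ := by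
  refine continuousOn_finsetSum _ fun j _ => (hσ i j).continuousOn.mul ?_
  exact (hu.continuousOn_fderiv_of_isOpen isOpen_compl_singleton le_rfl).clm_apply
    continuousOn_const

theorem continuousOn_gradL (hσ : ∀ i j, ContDiffOn ℝ 1 (fun x => σ x i j) {0}ᶜ)
    {u : EucN N → ℝ} (hu : ContDiffOn ℝ 1 u {0}ᶜ) : ContinuousOn (gradL σ u) {0}ᶜ :=
  (PiLp.continuous_toLp 2 _).comp_continuousOn
    (continuousOn_pi.2 fun i => continuousOn_vectorField hσ hu i)

theorem contDiffOn_vectorField (hσ : ∀ i j, ContDiffOn ℝ 1 (fun x => σ x i j) {0}ᶜ)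
    {u : EucN N → ℝ} (hu : ContDiffOn ℝ 2 u {0}ᶜ) (i : Fin h) :
    ContDiffOn ℝ 1 (vectorField σ i u) {0}ᶜ := by
  refine ContDiffOn.sum fun j _ => (hσ i j).mul ?_
  exact (hu.fderiv_of_isOpen isOpen_compl_singleton (by norm_num)).clm_apply contDiffOn_const

theorem contDiffOn_gradL (hσ : ∀ i j, ContDiffOn ℝ 1 (fun x => σ x i j) {0}ᶜ)
    {u : EucN N → ℝ} (hu : ContDiffOn ℝ 2 u {0}ᶜ) : ContDiffOn ℝ 1 (gradL σ u) {0}ᶜ :=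
  contDiffOn_euclidean.2 fun i => contDiffOn_vectorField hσ hu i

/-- The `p`-flux `‖∇_L d‖ ^ (p - 2) ∇_L d` tested against `∇_L φ`. -/
theorem integral_flux_add_opLp (hσ : ∀ i j, ContDiffOn ℝ 1 (fun x => σ x i j) {0}ᶜ)
    {d : EucN N → ℝ} (hd : ContDiffOn ℝ 2 d {0}ᶜ) {p : ℝ} (hp : 2 ≤ p) {φ : EucN N → ℝ}
    {K : Set (EucN N)} (hφ : ContDiffOn ℝ 1 φ {0}ᶜ) (hK : IsCompact K) (hK0 : K ⊆ {0}ᶜ)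
    (hs : ∀ x, x ∉ K → φ x = 0) :
    ∫ x, (‖gradL σ d x‖ ^ (p - 2) * inner ℝ (gradL σ φ x) (gradL σ d x) + φ x * opLp σ p d x)
      = 0 := by
  set W : Fin h → Fin N → EucN N → ℝ := fun i j y =>
    σ y i j * (‖gradL σ d y‖ ^ (p - 2) * vectorField σ i d y) with hW
  -- The flux is `C^1` even across the zeros of `∇_L d`, by `contDiff_norm_rpow_mul`; this is where
  -- `p ≥ 2` enters.
  have hWd : ∀ i j, ContDiffOn ℝ 1 (W i j) {0}ᶜ := fun i j =>
    (hσ i j).mul ((contDiff_norm_rpow_mul (sub_nonneg.2 hp)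
      (EuclideanSpace.proj (𝕜 := ℝ) i)).comp_contDiffOn (contDiffOn_gradL hσ hd))
  obtain ⟨hφ1, hφc, hφ0⟩ := hφ.contDiff_of_support_subset isOpen_compl_singleton hK hK0 hs
  have hφ' : ∀ x, x ∉ K → fderiv ℝ φ x = 0 := fun x hx =>
    fderiv_eq_zero_of_support_subset hK hs hx
  have hint : ∀ g : EucN N → ℝ, ContinuousOn g {0}ᶜ → (∀ x, x ∉ K → g x = 0) → Integrable g :=
    fun g hg hg0 => by
      obtain ⟨h1, h2⟩ := hg.continuous_of_support_subset isOpen_compl_singleton hK hK0 hg0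
      exact h1.integrable_of_hasCompactSupport h2
  have hφf : Continuous (fderiv ℝ φ) := hφ1.continuous_fderiv one_ne_zero
  have i1 : ∀ i j, Integrable fun x => fderiv ℝ φ x (EuclideanSpace.single j 1) * W i j x :=
    fun i j => hint _ ((hφf.clm_apply continuous_const).continuousOn.mul (hWd i j).continuousOn)
      fun x hx => by simp [hφ' x hx]
  have i2 : ∀ i j, Integrable fun x => φ x * fderiv ℝ (W i j) x (EuclideanSpace.single j 1) :=
    fun i j => hint _ (hφ1.continuous.continuousOn.mul
      (((hWd i j).continuousOn_fderiv_of_isOpen isOpen_compl_singleton le_rfl).clm_apply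
        continuousOn_const)) fun x hx => by simp [hs x hx]
  have i3 : ∀ i j, Integrable fun x => φ x * W i j x :=
    fun i j => hint _ (hφ1.continuous.continuousOn.mul (hWd i j).continuousOn)
      fun x hx => by simp [hs x hx]
  have key : ∀ i j, ∫ x, (fderiv ℝ φ x (EuclideanSpace.single j 1) * W i j x
      + φ x * fderiv ℝ (W i j) x (EuclideanSpace.single j 1)) = 0 := fun i j => by
    rw [integral_add (i1 i j) (i2 i j), integral_mul_fderiv_eq_neg_fderiv_mul_of_integrable
      (i1 i j) (i2 i j) (i3 i j) (fun x _ => hφ1.differentiable one_ne_zero x)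
      (fun x hx => ((hWd i j).contDiffAt
        (isOpen_compl_singleton.mem_nhds (hφ0 hx))).differentiableAt one_ne_zero)]
    ring
  have e : ∀ x, ‖gradL σ d x‖ ^ (p - 2) * inner ℝ (gradL σ φ x) (gradL σ d x)
      + φ x * opLp σ p d x = ∑ i, ∑ j, (fderiv ℝ φ x (EuclideanSpace.single j 1) * W i j x
      + φ x * fderiv ℝ (W i j) x (EuclideanSpace.single j 1)) := fun x => by
    simp only [Finset.sum_add_distrib, inner_gradL, opLp, formalAdjoint, Finset.sum_neg_distrib,
      neg_neg, Finset.mul_sum]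
    congr 1
    refine Finset.sum_congr rfl fun i _ => ?_
    rw [vectorField, Finset.sum_mul, Finset.mul_sum]
    refine Finset.sum_congr rfl fun j _ => ?_
    simp only [hW]
    ring
  have i4 : ∀ i j, Integrable fun x => fderiv ℝ φ x (EuclideanSpace.single j 1) * W i j x
      + φ x * fderiv ℝ (W i j) x (EuclideanSpace.single j 1) := fun i j => (i1 i j).add (i2 i j)
  simp_rw [e]
  rw [integral_finsetSum _ fun i _ => integrable_finsetSum _ fun j _ => i4 i j]
  refine Finset.sum_eq_zero fun i _ => ?_
  rw [integral_finsetSum _ fun j _ => i4 i j]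
  exact Finset.sum_eq_zero fun j _ => key i j

end Gradient

/-! ### The standing assumptions and the divergence-free flux of `d`. -/

/-- The standing assumptions: `C^1` vector fields off the origin, and a positive smooth function
`d` with `∇_L d ≠ 0` almost everywhere whose `p`-Laplacian is `(1 - β)(p - 1)‖∇_L d‖ ^ p / d`. -/
structure HardySetting {N h : ℕ} (σ : EucN N → Matrix (Fin h) (Fin N) ℝ) (d : EucN N → ℝ)
    (p β : ℝ) : Prop where
  contDiffOn_coeff : ∀ i j, ContDiffOn ℝ 1 (fun x => σ x i j) {0}ᶜ
  contDiffOn : ContDiffOn ℝ ∞ d {0}ᶜ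
  pos : ∀ x, x ≠ 0 → 0 < d x
  ae_gradL_ne_zero : ∀ᵐ x : EucN N, gradL σ d x ≠ 0
  two_le : 2 ≤ p
  opLp_eq : ∀ x, x ≠ 0 → opLp σ p d x = (1 - β) * (p - 1) * ‖gradL σ d x‖ ^ p / d x
  card_le : h ≤ N

namespace HardySetting

variable {N h : ℕ} {σ : EucN N → Matrix (Fin h) (Fin N) ℝ} {d : EucN N → ℝ} {p β : ℝ}

/-- In dimension zero `h ≤ N` forces `h = 0`, so `∇_L d` would vanish identically. Nontriviality
makes the origin a null set, so values there are irrelevant to the integrals. -/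
theorem nontrivial (H : HardySetting σ d p β) : Nontrivial (EucN N) := by
  rcases Nat.eq_zero_or_pos N with rfl | hN
  · obtain rfl : h = 0 := Nat.le_zero.1 H.card_le
    obtain ⟨x, hx⟩ := H.ae_gradL_ne_zero.exists
    exact absurd (Subsingleton.elim _ _) hx
  · have : NeZero N := ⟨hN.ne'⟩
    infer_instance

theorem ae_ne_zero (H : HardySetting σ d p β) : ∀ᵐ x : EucN N, x ≠ 0 := by
  have := H.nontrivial
  exact volume.ae_ne 0

theorem contDiffOn_one (H : HardySetting σ d p β) : ContDiffOn ℝ 1 d {0}ᶜ :=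
  H.contDiffOn.of_le (by exact_mod_cast le_top)

theorem hasFDerivAt (H : HardySetting σ d p β) {x : EucN N} (hx : x ≠ 0) :
    HasFDerivAt d (fderiv ℝ d x) x :=
  ((H.contDiffOn_one.contDiffAt (isOpen_compl_singleton.mem_nhds hx)).differentiableAt
    one_ne_zero).hasFDerivAt

theorem contDiffOn_rpow (H : HardySetting σ d p β) (s : ℝ) :
    ContDiffOn ℝ ∞ (fun x => d x ^ s) {0}ᶜ :=
  H.contDiffOn.rpow_const_of_ne fun x hx => (H.pos x hx).ne'

theorem hasFDerivAt_rpow (H : HardySetting σ d p β) (s : ℝ) {x : EucN N} (hx : x ≠ 0) :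
    HasFDerivAt (fun x => d x ^ s) ((s * d x ^ (s - 1)) • fderiv ℝ d x) x :=
  (H.hasFDerivAt hx).rpow_const (.inl (H.pos x hx).ne')

theorem continuousOn_gradL_self (H : HardySetting σ d p β) : ContinuousOn (gradL σ d) {0}ᶜ :=
  continuousOn_gradL H.contDiffOn_coeff H.contDiffOn_one

/-- The power `d ^ (-κ)` is an integrating factor: in testing with `χ d ^ (-κ)`, the term in which
`d ^ (-κ)` is differentiated cancels the `opLp` term exactly. -/
theorem integral_flux_eq_zero (H : HardySetting σ d p β) {χ : EucN N → ℝ}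
    {K : Set (EucN N)} (hχ : ContDiffOn ℝ 1 χ {0}ᶜ) (hK : IsCompact K) (hK0 : K ⊆ {0}ᶜ)
    (hs : ∀ x, x ∉ K → χ x = 0) :
    ∫ x, d x ^ (-((p - 1) * (1 - β))) *
      (‖gradL σ d x‖ ^ (p - 2) * inner ℝ (gradL σ χ x) (gradL σ d x)) = 0 := by
  set κ := (p - 1) * (1 - β) with hκ
  have h1 := integral_flux_add_opLp H.contDiffOn_coeff
    (contDiffOn_infty.1 H.contDiffOn 2) H.two_le
    (φ := fun x => χ x * d x ^ (-κ)) (K := K)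
    (hχ.mul ((H.contDiffOn_rpow _).of_le (by exact_mod_cast le_top))) hK hK0
    (fun x hx => by simp [hs x hx])
  rw [← h1]
  refine integral_congr_ae (H.ae_ne_zero.mono fun x hx => ?_)
  have hx' := H.pos x hx
  have hD := ((hχ.contDiffAt (isOpen_compl_singleton.mem_nhds hx)).differentiableAt
    one_ne_zero).hasFDerivAt.mul (H.hasFDerivAt_rpow (-κ) hx)
  rw [smul_smul, add_comm] at hD
  have hg : gradL σ (fun x => χ x * d x ^ (-κ)) x = _ := gradL_of_hasFDerivAt (σ := σ) hD
  simp only [hg, H.opLp_eq x hx, inner_add_left, inner_smul_left, real_inner_self_eq_norm_sq,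
    RCLike.conj_to_real]
  have e1 : ‖gradL σ d x‖ ^ p = ‖gradL σ d x‖ ^ (p - 2) * ‖gradL σ d x‖ ^ 2 := by
    rw [← Real.rpow_natCast, ← Real.rpow_add_of_nonneg (norm_nonneg _)
      (sub_nonneg.2 H.two_le) (by norm_num)]
    norm_num
  have e2 : d x ^ (-κ - 1) = d x ^ (-κ) / d x := Real.rpow_sub_one hx'.ne' _
  have e3 : (1 - β) * (p - 1) = κ := by rw [hκ]; ring
  rw [e1, e2, e3]
  field_simp
  ring

end HardySetting

/-! ### Test functions, the tangent gap and the Hardy inequality. -/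

namespace IsTest

variable {N : ℕ} {u : EucN N → ℝ}

theorem contDiff_one (hu : IsTest u) : ContDiff ℝ 1 u := hu.1.of_le (by exact_mod_cast le_top)

theorem apply_zero (hu : IsTest u) : u 0 = 0 :=
  image_eq_zero_of_notMem_tsupport fun h => hu.2.2 h rfl

theorem hasFDerivAt (hu : IsTest u) (x : EucN N) : HasFDerivAt u (fderiv ℝ u x) x :=
  (hu.contDiff_one.differentiable one_ne_zero x).hasFDerivAt

theorem integrable_of_continuousOn (hu : IsTest u) {g : EucN N → ℝ}
    (hg : ContinuousOn g {0}ᶜ) (h0 : ∀ x, x ∉ tsupport u → g x = 0) : Integrable g := by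
  obtain ⟨h1, h2⟩ := hg.continuous_of_support_subset isOpen_compl_singleton hu.2.1.isCompact
    hu.2.2 h0
  exact h1.integrable_of_hasCompactSupport h2

theorem gradL_eq_zero (hu : IsTest u) {h : ℕ} {σ : EucN N → Matrix (Fin h) (Fin N) ℝ}
    {x : EucN N} (hx : x ∉ tsupport u) : gradL σ u x = 0 :=
  gradL_eq_zero_of_fderiv <| fderiv_eq_zero_of_support_subset hu.2.1.isCompact
    (fun _ h => image_eq_zero_of_notMem_tsupport h) hx

end IsTest

/-- The density `|u| ^ (p - 2) u ‖∇_L d‖ ^ (p - 2) (∇_L u · ∇_L d) d ^ (1 - p θ)`. -/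
noncomputable def crossDensity {N h : ℕ} (σ : EucN N → Matrix (Fin h) (Fin N) ℝ)
    (d : EucN N → ℝ) (p θ : ℝ) (u : EucN N → ℝ) (x : EucN N) : ℝ :=
  |u x| ^ (p - 2) * u x * (‖gradL σ d x‖ ^ (p - 2) * inner ℝ (gradL σ u x) (gradL σ d x)) *
    d x ^ (1 - p * θ)

/-- The gap in the tangent line inequality between `α u d ^ (-θ) ‖∇_L d‖` and
`d ^ (1 - θ) (∇_L u · ∇_L d) / ‖∇_L d‖`. -/
noncomputable def tangentGap {N h : ℕ} (σ : EucN N → Matrix (Fin h) (Fin N) ℝ)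
    (d : EucN N → ℝ) (p β θ : ℝ) (u : EucN N → ℝ) (x : EucN N) : ℝ :=
  radialDensity σ d p θ u x - |hardyExp p β θ| ^ p * massDensity σ d p θ u x -
    p * (|hardyExp p β θ| ^ (p - 2) * hardyExp p β θ * crossDensity σ d p θ u x -
      |hardyExp p β θ| ^ p * massDensity σ d p θ u x)

theorem radialDensity_le_gradientDensity {N h : ℕ} {σ : EucN N → Matrix (Fin h) (Fin N) ℝ}
    {d : EucN N → ℝ} {p : ℝ} (hp : 2 ≤ p) (θ : ℝ) (u : EucN N → ℝ) {x : EucN N}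
    (hx : 0 < d x) : radialDensity σ d p θ u x ≤ gradientDensity σ d p θ u x := by
  have hp0 : 0 < p := by linarith
  have hd : 0 < d x ^ (p * (θ - 1)) := by positivity
  rw [radialDensity, gradientDensity, div_mul_eq_mul_div]
  refine div_le_div_of_nonneg_right ?_ hd.le
  rcases eq_or_ne (gradL σ d x) 0 with h0 | h0
  · simp only [h0, inner_zero_right, abs_zero, Real.zero_rpow hp0.ne', zero_mul]
    positivity
  · have : 0 < ‖gradL σ d x‖ := norm_pos_iff.2 h0
    rw [mul_one_div, div_le_iff₀ (by positivity), ← Real.mul_rpow (norm_nonneg _) (norm_nonneg _)]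
    exact Real.rpow_le_rpow (abs_nonneg _) (abs_real_inner_le_norm _ _) hp0.le

namespace HardySetting

variable {N h : ℕ} {σ : EucN N → Matrix (Fin h) (Fin N) ℝ} {d : EucN N → ℝ} {p β : ℝ}

/-- The terms match as `|b| ^ p` with the radial density, `|a| ^ p` with `|α| ^ p` times the mass
density, and `|a| ^ (p - 2) a b` with the cross density. At zeros of `∇_L d` the quotient in `b` is
`0` by convention and all terms vanish. -/
theorem tangentGap_eq (H : HardySetting σ d p β) (θ : ℝ) (u : EucN N → ℝ) {x : EucN N}
    (hx : x ≠ 0) :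
    let a := hardyExp p β θ * (u x * d x ^ (-θ) * ‖gradL σ d x‖)
    let b := d x ^ (1 - θ) * (inner ℝ (gradL σ u x) (gradL σ d x) / ‖gradL σ d x‖)
    tangentGap σ d p β θ u x = |b| ^ p - |a| ^ p - p * (|a| ^ (p - 2) * a) * (b - a) := by
  rw [tangentGap]
  generalize hardyExp p β θ = α
  intro a b
  have hp := H.two_le
  have hp0 : 0 < p := by linarith
  have hx' := H.pos x hx
  set g := ‖gradL σ d x‖ with hg
  have hg0 : 0 ≤ g := norm_nonneg _
  have hb : |b| ^ p = radialDensity σ d p θ u x := by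
    simp only [b, radialDensity, abs_mul, abs_div, abs_of_nonneg hg0,
      abs_of_pos (Real.rpow_pos_of_pos hx' (1 - θ)), ← hg]
    rw [Real.mul_rpow (by positivity) (by positivity), Real.div_rpow (abs_nonneg _) hg0,
      ← Real.rpow_mul hx'.le, show (1 - θ) * p = -(p * (θ - 1)) by ring, Real.rpow_neg hx'.le]
    ring
  have ha : |a| = |α| * (|u x| * d x ^ (-θ) * g) := by
    simp only [a, abs_mul, abs_of_nonneg hg0,
      abs_of_pos (Real.rpow_pos_of_pos hx' (-θ)), ← hg]
  have hapow : ∀ q, |a| ^ q = |α| ^ q * (|u x| ^ q * d x ^ (-(q * θ)) * g ^ q) := fun q => by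
    rw [ha, Real.mul_rpow (abs_nonneg _) (by positivity), Real.mul_rpow (by positivity) hg0,
      Real.mul_rpow (abs_nonneg _) (by positivity), ← Real.rpow_mul hx'.le]
    ring_nf
  have ha' : |a| ^ p = |α| ^ p * massDensity σ d p θ u x := by
    rw [hapow, massDensity, Real.rpow_neg hx'.le]
    ring
  have haa : |a| ^ (p - 2) * a * a = |a| ^ p := by
    rw [mul_assoc, ← abs_mul_abs_self a, ← pow_two, ← Real.rpow_natCast,
      ← Real.rpow_add_of_nonneg (abs_nonneg _) (by linarith) (by norm_num)]
    norm_num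
  have hab : |a| ^ (p - 2) * a * b = |α| ^ (p - 2) * α * crossDensity σ d p θ u x := by
    rw [hapow, crossDensity, show 1 - p * θ = -((p - 2) * θ) + (-θ + (1 - θ)) by ring,
      Real.rpow_add hx', Real.rpow_add hx']
    rcases hg0.eq_or_lt with h0 | h0
    · have : gradL σ d x = 0 := norm_eq_zero.1 h0.symm
      simp [a, ← h0, this]
    · simp only [a, b, ← hg]
      field_simp
  rw [← hb, ← ha', ← hab, ← haa]
  ring

theorem tangentGap_nonneg (H : HardySetting σ d p β) (θ : ℝ) (u : EucN N → ℝ) {x : EucN N}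
    (hx : x ≠ 0) : 0 ≤ tangentGap σ d p β θ u x := by
  rw [H.tangentGap_eq θ u hx]
  exact abs_rpow_tangent_le H.two_le _ _

variable {u : EucN N → ℝ}

theorem continuousOn_gradL_test (H : HardySetting σ d p β) (hu : IsTest u) :
    ContinuousOn (gradL σ u) {0}ᶜ :=
  continuousOn_gradL H.contDiffOn_coeff hu.contDiff_one.contDiffOn

theorem integrable_massDensity (H : HardySetting σ d p β) (θ : ℝ) (hu : IsTest u) :
    Integrable (massDensity σ d p θ u) := by
  have hp0 : 0 < p := by linarith [H.two_le]
  refine hu.integrable_of_continuousOn ?_ fun x hx => by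
    simp [massDensity, image_eq_zero_of_notMem_tsupport hx, Real.zero_rpow hp0.ne']
  refine ((hu.1.continuous.abs.rpow_const fun _ => .inr hp0.le).continuousOn.div
    (H.contDiffOn_rpow _).continuousOn fun x hx => (Real.rpow_pos_of_pos (H.pos x hx) _).ne').mul
    (H.continuousOn_gradL_self.norm.rpow_const fun _ _ => .inr hp0.le)

theorem integrable_gradientDensity (H : HardySetting σ d p β) (θ : ℝ) (hu : IsTest u) :
    Integrable (gradientDensity σ d p θ u) := by
  have hp0 : 0 < p := by linarith [H.two_le]
  refine hu.integrable_of_continuousOn ?_ fun x hx => by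
    simp [gradientDensity, hu.gradL_eq_zero hx, Real.zero_rpow hp0.ne']
  exact ((H.continuousOn_gradL_test hu).norm.rpow_const fun _ _ => .inr hp0.le).div
    (H.contDiffOn_rpow _).continuousOn fun x hx => (Real.rpow_pos_of_pos (H.pos x hx) _).ne'

theorem integrable_crossDensity (H : HardySetting σ d p β) (θ : ℝ) (hu : IsTest u) :
    Integrable (crossDensity σ d p θ u) := by
  have hp2 : 0 ≤ p - 2 := by linarith [H.two_le]
  refine hu.integrable_of_continuousOn ?_ fun x hx => by
    simp [crossDensity, image_eq_zero_of_notMem_tsupport hx]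
  exact (((hu.1.continuous.abs.rpow_const fun _ => .inr hp2).mul hu.1.continuous).continuousOn.mul
    ((H.continuousOn_gradL_self.norm.rpow_const fun _ _ => .inr hp2).mul
      ((H.continuousOn_gradL_test hu).inner H.continuousOn_gradL_self))).mul
    (H.contDiffOn_rpow _).continuousOn

theorem ae_radialDensity_le (H : HardySetting σ d p β) (θ : ℝ) (u : EucN N → ℝ) :
    ∀ᵐ x, radialDensity σ d p θ u x ≤ gradientDensity σ d p θ u x :=
  H.ae_ne_zero.mono fun x hx => radialDensity_le_gradientDensity H.two_le θ u (H.pos x hx)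

/-- The factor `1 / ‖∇_L d‖ ^ p` need not be continuous at zeros of `∇_L d`, so the density is only
shown measurable and is dominated by `gradientDensity`. -/
theorem integrable_radialDensity (H : HardySetting σ d p β) (θ : ℝ) (hu : IsTest u) :
    Integrable (radialDensity σ d p θ u) := by
  have hp0 : 0 < p := by linarith [H.two_le]
  have hr : (volume : Measure (EucN N)).restrict {0}ᶜ = volume :=
    Measure.restrict_eq_self_of_ae_mem H.ae_ne_zero
  refine (H.integrable_gradientDensity θ hu).mono' ?_ ?_
  · have h1 : ContinuousOn (fun x => |inner ℝ (gradL σ u x) (gradL σ d x)| ^ p /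
        d x ^ (p * (θ - 1))) {0}ᶜ :=
      (((H.continuousOn_gradL_test hu).inner H.continuousOn_gradL_self).abs.rpow_const
        fun _ _ => .inr hp0.le).div
      (H.contDiffOn_rpow _).continuousOn fun x hx => (Real.rpow_pos_of_pos (H.pos x hx) _).ne'
    have h2 : ContinuousOn (fun x => ‖gradL σ d x‖ ^ p) {0}ᶜ :=
      H.continuousOn_gradL_self.norm.rpow_const fun _ _ => .inr hp0.le
    have m1 := h1.aestronglyMeasurable (μ := volume) isOpen_compl_singleton.measurableSet
    have m2 := h2.aestronglyMeasurable (μ := volume) isOpen_compl_singleton.measurableSet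
    rw [hr] at m1 m2
    exact m1.mul (aestronglyMeasurable_const.div₀ m2)
  · filter_upwards [H.ae_ne_zero, H.ae_radialDensity_le θ u] with x hx hle
    have := Real.rpow_pos_of_pos (H.pos x hx) (p * (θ - 1))
    rwa [Real.norm_of_nonneg (by rw [radialDensity]; positivity)]

theorem radialInt_le_gradientInt (H : HardySetting σ d p β) (θ : ℝ) (hu : IsTest u) :
    radialInt σ d p θ u ≤ gradientInt σ d p θ u :=
  integral_mono_ae (H.integrable_radialDensity θ hu) (H.integrable_gradientDensity θ hu)
    (H.ae_radialDensity_le θ u)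

theorem mul_hardyExp (H : HardySetting σ d p β) (θ : ℝ) :
    p * hardyExp p β θ = p * θ - 1 - (p - 1) * (1 - β) := by
  have : p ≠ 0 := by linarith [H.two_le]
  rw [hardyExp]
  field_simp
  ring

/-- This is where `α` arises: the divergence-free field is tested against `|u| ^ p d ^ (-pα)`.
Differentiating `|u| ^ p` gives the cross density and differentiating `d ^ (-pα)` gives the mass
density, the powers of `d` matching because `pα = pθ - 1 - κ`. -/
theorem integral_crossDensity (H : HardySetting σ d p β) (θ : ℝ) (hu : IsTest u) :
    ∫ x, crossDensity σ d p θ u x = hardyExp p β θ * massInt σ d p θ u := by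
  have hp := H.two_le
  have hp0 : p ≠ 0 := by linarith
  have hp1 : 1 < p := by linarith
  set α := hardyExp p β θ with hα
  have hpα := H.mul_hardyExp θ
  rw [← hα] at hpα
  have hχ : ContDiffOn ℝ 1 (fun x => |u x| ^ p * d x ^ (-(p * α))) {0}ᶜ := by
    have := (hu.contDiff_one.norm_rpow hp1).contDiffOn (s := {0}ᶜ)
    simp_rw [Real.norm_eq_abs] at this
    exact this.mul ((H.contDiffOn_rpow _).of_le (by exact_mod_cast le_top))
  have key := H.integral_flux_eq_zero hχ hu.2.1.isCompact hu.2.2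
    (fun x hx => by simp [image_eq_zero_of_notMem_tsupport hx, Real.zero_rpow hp0])
  have e : ∀ x, x ≠ 0 → d x ^ (-((p - 1) * (1 - β))) * (‖gradL σ d x‖ ^ (p - 2) *
      inner ℝ (gradL σ (fun x => |u x| ^ p * d x ^ (-(p * α))) x) (gradL σ d x)) =
      p * crossDensity σ d p θ u x - p * α * massDensity σ d p θ u x := fun x hx => by
    have hx' := H.pos x hx
    have hD := ((hasDerivAt_abs_rpow (u x) hp1).comp_hasFDerivAt x (hu.hasFDerivAt x)).mul
      (H.hasFDerivAt_rpow (-(p * α)) hx)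
    rw [smul_smul, smul_smul, add_comm] at hD
    have hg : gradL σ (fun x => |u x| ^ p * d x ^ (-(p * α))) x = _ :=
      gradL_of_hasFDerivAt (σ := σ) hD
    have e1 : ‖gradL σ d x‖ ^ p = ‖gradL σ d x‖ ^ (p - 2) * ‖gradL σ d x‖ ^ 2 := by
      rw [← Real.rpow_natCast, ← Real.rpow_add_of_nonneg (norm_nonneg _)
        (sub_nonneg.2 H.two_le) (by norm_num)]
      norm_num
    have e2 : d x ^ (1 - p * θ) = d x ^ (-((p - 1) * (1 - β))) * d x ^ (-(p * α)) := by
      rw [← Real.rpow_add hx', hpα]; ring_nf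
    have e3 : 1 / d x ^ (p * θ) =
        d x ^ (-((p - 1) * (1 - β))) * d x ^ (-(p * α) - 1) := by
      rw [← Real.rpow_add hx', one_div, ← Real.rpow_neg hx'.le, hpα]; ring_nf
    simp only [hg, inner_add_left, inner_smul_left, real_inner_self_eq_norm_sq,
      RCLike.conj_to_real, crossDensity, massDensity, Function.comp_apply]
    rw [e1, e2, div_eq_mul_one_div (|u x| ^ p) (d x ^ (p * θ)), e3]
    ring
  rw [integral_congr_ae (H.ae_ne_zero.mono fun x hx => e x hx), integral_sub
    ((H.integrable_crossDensity θ hu).const_mul p)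
    ((H.integrable_massDensity θ hu).const_mul (p * α)), integral_const_mul,
    integral_const_mul] at key
  have : p * (∫ x, crossDensity σ d p θ u x) = p * (α * massInt σ d p θ u) := by
    rw [massInt]; linarith
  exact mul_left_cancel₀ hp0 this

theorem integrable_tangentGap (H : HardySetting σ d p β) (θ : ℝ) (hu : IsTest u) :
    Integrable (tangentGap σ d p β θ u) :=
  ((H.integrable_radialDensity θ hu).sub ((H.integrable_massDensity θ hu).const_mul _)).sub
    ((((H.integrable_crossDensity θ hu).const_mul _).sub
      ((H.integrable_massDensity θ hu).const_mul _)).const_mul p)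

/-- The linear term of the gap integrates to zero, since `|α| ^ (p - 2) α · α M = |α| ^ p M`. -/
theorem integral_tangentGap (H : HardySetting σ d p β) (θ : ℝ) (hu : IsTest u) :
    ∫ x, tangentGap σ d p β θ u x =
      radialInt σ d p θ u - |hardyExp p β θ| ^ p * massInt σ d p θ u := by
  have hR := H.integrable_radialDensity θ hu
  have hM := (H.integrable_massDensity θ hu).const_mul (|hardyExp p β θ| ^ p)
  have hC := (H.integrable_crossDensity θ hu).const_mul
    (|hardyExp p β θ| ^ (p - 2) * hardyExp p β θ)
  have haa : |hardyExp p β θ| ^ (p - 2) * hardyExp p β θ * hardyExp p β θ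
      = |hardyExp p β θ| ^ p := by
    rw [mul_assoc, ← abs_mul_abs_self (hardyExp p β θ), ← pow_two, ← Real.rpow_natCast,
      ← Real.rpow_add_of_nonneg (abs_nonneg _) (by linarith [H.two_le]) (by norm_num)]
    norm_num
  have h1 : ∫ x, tangentGap σ d p β θ u x = _ := integral_sub (hR.sub hM) ((hC.sub hM).const_mul p)
  have h2 : ∫ x, (radialDensity σ d p θ u x - |hardyExp p β θ| ^ p * massDensity σ d p θ u x)
    = _ := integral_sub hR hM
  have h3 : ∫ x, (|hardyExp p β θ| ^ (p - 2) * hardyExp p β θ * crossDensity σ d p θ u x -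
      |hardyExp p β θ| ^ p * massDensity σ d p θ u x) = _ := integral_sub hC hM
  rw [h1, integral_const_mul]
  rw [h2, h3, integral_const_mul, integral_const_mul, H.integral_crossDensity θ hu, ← mul_assoc,
    haa, radialInt, massInt]
  ring

/-- The Hardy inequality. -/
theorem massInt_le_radialInt (H : HardySetting σ d p β) (θ : ℝ) (hu : IsTest u) :
    |hardyExp p β θ| ^ p * massInt σ d p θ u ≤ radialInt σ d p θ u := by
  have := integral_nonneg_of_ae (H.ae_ne_zero.mono fun x hx => H.tangentGap_nonneg θ u hx)
  rw [H.integral_tangentGap θ hu] at this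
  linarith

theorem massDensity_nonneg (H : HardySetting σ d p β) (θ : ℝ) (u : EucN N → ℝ) :
    0 ≤ᵐ[volume] massDensity σ d p θ u :=
  H.ae_ne_zero.mono fun x hx => by
    have := Real.rpow_pos_of_pos (H.pos x hx) (p * θ)
    simp only [Pi.zero_apply, massDensity]
    positivity

theorem massInt_nonneg (H : HardySetting σ d p β) (θ : ℝ) (u : EucN N → ℝ) :
    0 ≤ massInt σ d p θ u := integral_nonneg_of_ae (H.massDensity_nonneg θ u)

theorem eqOn_zero_of_ae {F : Type*} [TopologicalSpace F] [T2Space F]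
    [Zero F] {f : EucN N → F} (hf : ContinuousOn f {0}ᶜ) (h0 : ∀ᵐ x, f x = 0) {x : EucN N}
    (hx : x ≠ 0) : f x = 0 := by
  have := Measure.eqOn_open_of_ae_eq (μ := volume) (f := f) (g := fun _ => 0)
    (ae_restrict_of_ae h0) isOpen_compl_singleton hf continuousOn_const
  exact this hx

theorem massInt_pos (H : HardySetting σ d p β) (θ : ℝ) (hu : IsTest u) (hu0 : u ≠ 0) :
    0 < massInt σ d p θ u := by
  refine (H.massInt_nonneg θ u).lt_of_ne fun h => hu0 ?_
  have h1 := (integral_eq_zero_iff_of_nonneg_ae (H.massDensity_nonneg θ u)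
    (H.integrable_massDensity θ hu)).1 h.symm
  have h2 : ∀ᵐ x, u x = 0 := by
    filter_upwards [h1, H.ae_ne_zero, H.ae_gradL_ne_zero] with x hx hx0 hxg
    by_contra hux
    have hd := Real.rpow_pos_of_pos (H.pos x hx0) (p * θ)
    have hg := Real.rpow_pos_of_pos (norm_pos_iff.2 hxg) p
    have hu' := Real.rpow_pos_of_pos (abs_pos.2 hux) p
    exact (show massDensity σ d p θ u x ≠ 0 by rw [massDensity]; positivity) hx
  funext x
  rcases eq_or_ne x 0 with rfl | hx
  · exact hu.apply_zero
  · exact eqOn_zero_of_ae hu.1.continuous.continuousOn h2 hx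

/-! ### Rigidity in the equality case. -/

theorem hasFDerivAt_rpow_mul (H : HardySetting σ d p β) (s : ℝ) {u : EucN N → ℝ} {x : EucN N}
    (hx : x ≠ 0) (hu : DifferentiableAt ℝ u x) :
    HasFDerivAt (fun y => d y ^ s * u y)
      (d x ^ s • fderiv ℝ u x + (u x * (s * d x ^ (s - 1))) • fderiv ℝ d x) x := by
  have := (H.hasFDerivAt_rpow s hx).mul hu.hasFDerivAt
  rwa [smul_smul] at this

/-- Functions attaining equality are, up to the factor `d ^ α`, annihilated by `∇_L`. -/
theorem gradL_eq_zero_of_achievesBoth (H : HardySetting σ d p β) {θ : ℝ}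
    (hu : AchievesBoth σ d p β θ u) {x : EucN N} (hx : x ≠ 0) :
    gradL σ (fun y => d y ^ (-hardyExp p β θ) * u y) x = 0 := by
  obtain ⟨hu1, U, hU, hlim, hlim', hR, hG⟩ := hu
  have hp := H.two_le
  have hp0 : 0 < p := by linarith
  set α := hardyExp p β θ with hα
  have hgl : ∀ x, x ≠ 0 → Tendsto (fun n => gradL σ (U n) x) atTop (𝓝 (gradL σ u x)) := by
    intro x hx
    refine ((PiLp.continuous_toLp 2 _).tendsto _).comp (tendsto_pi_nhds.2 fun i => ?_)
    refine tendsto_finsetSum _ fun j _ => Tendsto.const_mul _ ?_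
    exact ((ContinuousLinearMap.apply ℝ ℝ (EuclideanSpace.single j (1 : ℝ))).continuous.tendsto
      _).comp (hlim'.tendsto_at hx)
  have hrad : ∀ x, x ≠ 0 → Tendsto (fun n => radialDensity σ d p θ (U n) x) atTop
      (𝓝 (radialDensity σ d p θ u x)) := fun x hx =>
    ((((hgl x hx).inner tendsto_const_nhds).abs.rpow_const (.inr hp0.le)).div_const _).mul_const _
  have hmass : ∀ x, x ≠ 0 → Tendsto (fun n => massDensity σ d p θ (U n) x) atTop
      (𝓝 (massDensity σ d p θ u x)) := fun x hx =>
    (((hlim.tendsto_at hx).abs.rpow_const (.inr hp0.le)).div_const _).mul_const _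
  have hgrad : ∀ x, x ≠ 0 → Tendsto (fun n => gradientDensity σ d p θ (U n) x) atTop
      (𝓝 (gradientDensity σ d p θ u x)) := fun x hx =>
    ((hgl x hx).norm.rpow_const (.inr hp0.le)).div_const _
  have hcross : ∀ x, x ≠ 0 → Tendsto (fun n => crossDensity σ d p θ (U n) x) atTop
      (𝓝 (crossDensity σ d p θ u x)) := fun x hx =>
    ((((hlim.tendsto_at hx).abs.rpow_const (.inr (by linarith))).mul (hlim.tendsto_at hx)).mul
      (((hgl x hx).inner tendsto_const_nhds).const_mul _)).mul_const _
  -- `C^1_loc` convergence makes all densities converge pointwise off the origin, so the Fatou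
  -- argument applies to each nonnegative gap.
  have z1 : ∀ᵐ x, tangentGap σ d p β θ u x = 0 := by
    refine ae_eq_zero_of_tendsto_integral_zero (fun n => H.integrable_tangentGap θ (hU n))
      (fun n => H.ae_ne_zero.mono fun x hx => H.tangentGap_nonneg θ (U n) hx)
      (H.ae_ne_zero.mono fun x hx => ?_) ?_
    · exact ((hrad x hx).sub ((hmass x hx).const_mul _)).sub
        ((((hcross x hx).const_mul _).sub ((hmass x hx).const_mul _)).const_mul _)
    · simp_rw [H.integral_tangentGap θ (hU _)]
      exact hR
  have z2 : ∀ᵐ x, gradientDensity σ d p θ u x - radialDensity σ d p θ u x = 0 := by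
    refine ae_eq_zero_of_tendsto_integral_zero
      (fun n => (H.integrable_gradientDensity θ (hU n)).sub (H.integrable_radialDensity θ (hU n)))
      (fun n => (H.ae_radialDensity_le θ (U n)).mono fun x hx => sub_nonneg.2 hx)
      (H.ae_ne_zero.mono fun x hx => (hgrad x hx).sub (hrad x hx)) ?_
    have e : ∀ n, ∫ x, ((gradientDensity σ d p θ (U n) - radialDensity σ d p θ (U n)) x) =
        gradientInt σ d p θ (U n) - radialInt σ d p θ (U n) := fun n =>
      integral_sub (H.integrable_gradientDensity θ (hU n)) (H.integrable_radialDensity θ (hU n))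
    simp_rw [e]
    exact hG
  have hv : ContDiffOn ℝ 1 (fun y => d y ^ (-α) * u y) {0}ᶜ :=
    ((H.contDiffOn_rpow _).of_le (by exact_mod_cast le_top)).mul hu1
  refine eqOn_zero_of_ae (continuousOn_gradL H.contDiffOn_coeff hv) ?_ hx
  filter_upwards [z1, z2, H.ae_ne_zero, H.ae_gradL_ne_zero] with x h1 h2 hx hg
  have hx' := H.pos x hx
  have hg' : 0 < ‖gradL σ d x‖ := norm_pos_iff.2 hg
  rw [H.tangentGap_eq θ u hx] at h1
  -- Strict convexity: a vanishing tangent gap forces `a = b`.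
  have h3 : α * (u x * d x ^ (-θ) * ‖gradL σ d x‖) =
      d x ^ (1 - θ) * (inner ℝ (gradL σ u x) (gradL σ d x) / ‖gradL σ d x‖) := by
    by_contra hne
    exact (abs_rpow_tangent_lt hp hne).ne' h1
  have h4 : α * u x * ‖gradL σ d x‖ ^ 2 = d x * inner ℝ (gradL σ u x) (gradL σ d x) := by
    have hdp := Real.rpow_pos_of_pos hx' (-θ)
    rw [show 1 - θ = -θ + 1 by ring, Real.rpow_add_one hx'.ne'] at h3
    field_simp at h3
    linarith
  have h5 : |inner ℝ (gradL σ u x) (gradL σ d x)| = ‖gradL σ u x‖ * ‖gradL σ d x‖ := by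
    have hdp := Real.rpow_pos_of_pos hx' (p * (θ - 1))
    have hgp := Real.rpow_pos_of_pos hg' p
    rw [gradientDensity, radialDensity, sub_eq_zero] at h2
    field_simp at h2
    rw [← Real.mul_rpow (norm_nonneg _) (norm_nonneg _)] at h2
    exact (Real.rpow_left_inj (abs_nonneg _) (by positivity) hp0.ne').1 h2.symm
  have h7 : inner ℝ (gradL σ u x) (gradL σ d x) = α * u x / d x * ‖gradL σ d x‖ ^ 2 := by
    field_simp
    linarith
  have h8 : ‖gradL σ u x‖ ^ 2 = (α * u x / d x) ^ 2 * ‖gradL σ d x‖ ^ 2 := by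
    refine mul_right_cancel₀ (pow_pos hg' 2).ne' ?_
    rw [← mul_pow, ← h5, sq_abs, h7]
    ring
  -- Equality in Cauchy–Schwarz, obtained by expanding the squared norm of the difference.
  have h6 : gradL σ u x = (α * u x / d x) • gradL σ d x := by
    rw [← sub_eq_zero, ← norm_eq_zero, ← sq_eq_zero_iff, norm_sub_sq_real, inner_smul_right,
      norm_smul, mul_pow, Real.norm_eq_abs, sq_abs,
      h7, h8]
    ring
  rw [gradL_of_hasFDerivAt (H.hasFDerivAt_rpow_mul (-α) hx ((hu1.contDiffAt
    (isOpen_compl_singleton.mem_nhds hx)).differentiableAt one_ne_zero)), h6, smul_smul,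
    ← add_smul, Real.rpow_sub_one hx'.ne']
  convert zero_smul ℝ (gradL σ d x) using 2
  field_simp
  ring

end HardySetting

/-! ### The weighted measure seen through `log d`. -/

/-- The density `d ^ (-(p - 1)(1 - β) - 1) ‖∇_L d‖ ^ p`, whose image under `log d` is a multiple of
Lebesgue measure. -/
noncomputable def logWeight {N h : ℕ} (σ : EucN N → Matrix (Fin h) (Fin N) ℝ)
    (d : EucN N → ℝ) (p β : ℝ) (x : EucN N) : ℝ :=
  d x ^ (-((p - 1) * (1 - β)) - 1) * ‖gradL σ d x‖ ^ p

/-- The function `d ^ a g(log d)`, extended by zero at the origin. -/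
noncomputable def logRadial {N : ℕ} (d : EucN N → ℝ) (a : ℝ) (g : ℝ → ℝ) : EucN N → ℝ :=
  indicator {0}ᶜ fun x => d x ^ a * g (Real.log (d x))

namespace HardySetting

variable {N h : ℕ} {σ : EucN N → Matrix (Fin h) (Fin N) ℝ} {d : EucN N → ℝ} {p β : ℝ}

theorem contDiffOn_log (H : HardySetting σ d p β) :
    ContDiffOn ℝ ∞ (fun x => Real.log (d x)) {0}ᶜ :=
  H.contDiffOn.log fun x hx => (H.pos x hx).ne'

theorem hasFDerivAt_comp_log (H : HardySetting σ d p β) {η : ℝ → ℝ} {η' : ℝ} {x : EucN N}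
    (hx : x ≠ 0) (hη : HasDerivAt η η' (Real.log (d x))) :
    HasFDerivAt (fun x => η (Real.log (d x))) ((η' / d x) • fderiv ℝ d x) x := by
  have := hη.comp_hasFDerivAt x ((H.hasFDerivAt hx).log (H.pos x hx).ne')
  rwa [smul_smul, ← div_eq_mul_inv] at this

theorem exists_isCompact_log (H : HardySetting σ d p β)
    (hK : ∀ a b : ℝ, 0 < a → a ≤ b → IsCompact {x : EucN N | x ≠ 0 ∧ a ≤ d x ∧ d x ≤ b})
    {g : ℝ → ℝ} (hg : HasCompactSupport g) :
    ∃ K : Set (EucN N), IsCompact K ∧ K ⊆ {0}ᶜ ∧ ∀ x, x ≠ 0 → x ∉ K → g (Real.log (d x)) = 0 := by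
  obtain ⟨R, hR⟩ := hg.isCompact.isBounded.subset_closedBall 0
  refine ⟨_, hK (Real.exp (-|R|)) (Real.exp |R|) (Real.exp_pos _)
    (Real.exp_le_exp.2 (by linarith [abs_nonneg R])), fun x hx => hx.1, fun x hx hxK => ?_⟩
  refine image_eq_zero_of_notMem_tsupport fun h => hxK ⟨hx, ?_⟩
  have h1 := hR h
  rw [mem_closedBall_zero_iff, Real.norm_eq_abs] at h1
  have h2 := abs_le.1 (h1.trans (le_abs_self R))
  exact ⟨(Real.le_log_iff_exp_le (H.pos x hx)).1 h2.1,
    (Real.log_le_iff_le_exp (H.pos x hx)).1 h2.2⟩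

theorem integrable_mul_log (H : HardySetting σ d p β)
    (hK : ∀ a b : ℝ, 0 < a → a ≤ b → IsCompact {x : EucN N | x ≠ 0 ∧ a ≤ d x ∧ d x ≤ b})
    {v : EucN N → ℝ} (hv : ContinuousOn v {0}ᶜ) {g : ℝ → ℝ} (hg : Continuous g)
    (hc : HasCompactSupport g) :
    Integrable fun x => v x * g (Real.log (d x)) * logWeight σ d p β x := by
  obtain ⟨K, hK1, hK2, hK3⟩ := H.exists_isCompact_log hK hc
  have hcont : ContinuousOn (fun x => v x * g (Real.log (d x)) * logWeight σ d p β x) {0}ᶜ :=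
    (hv.mul (hg.comp_continuousOn H.contDiffOn_log.continuousOn)).mul
      ((H.contDiffOn_rpow _).continuousOn.mul (H.continuousOn_gradL_self.norm.rpow_const
        fun _ _ => .inr (by linarith [H.two_le])))
  obtain ⟨h1, h2⟩ := (hcont.congr fun x hx => indicator_of_mem hx _).continuous_of_support_subset
    (f := indicator {0}ᶜ fun x => v x * g (Real.log (d x)) * logWeight σ d p β x)
    isOpen_compl_singleton hK1 hK2 fun x hx => by
      by_cases h0 : x = 0
      · simp [h0]
      · simp [h0, hK3 x h0 hx]
  refine (h1.integrable_of_hasCompactSupport h2).congr (H.ae_ne_zero.mono fun x hx => ?_)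
  exact indicator_of_mem hx _

/-- The test function is `v η(log d)` with `η' = g`. As `∇_L v = 0`, the factor `v` behaves like a
constant, and the flux identity leaves exactly this integral. -/
theorem integral_mul_log_eq_zero (H : HardySetting σ d p β)
    (hK : ∀ a b : ℝ, 0 < a → a ≤ b → IsCompact {x : EucN N | x ≠ 0 ∧ a ≤ d x ∧ d x ≤ b})
    {v : EucN N → ℝ} (hv : ContDiffOn ℝ 1 v {0}ᶜ) (hv0 : ∀ x, x ≠ 0 → gradL σ v x = 0)
    {g : ℝ → ℝ} (hg : Continuous g) (hc : HasCompactSupport g) (h0 : ∫ t, g t = 0) :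
    ∫ x, v x * g (Real.log (d x)) * logWeight σ d p β x = 0 := by
  obtain ⟨η, hη1, hηc, hη⟩ := exists_primitive_of_integral_eq_zero hg hc h0
  obtain ⟨K, hK1, hK2, hK3⟩ := H.exists_isCompact_log hK hηc
  set χ : EucN N → ℝ := indicator {0}ᶜ fun x => v x * η (Real.log (d x)) with hχ
  have hχ1 : ContDiffOn ℝ 1 χ {0}ᶜ :=
    (hv.mul (hη1.comp_contDiffOn (H.contDiffOn_log.of_le (by exact_mod_cast le_top)))).congr
      fun x hx => indicator_of_mem hx _
  rw [← H.integral_flux_eq_zero hχ1 hK1 hK2 fun x hx => by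
      by_cases h0 : x = 0
      · simp [hχ, h0]
      · simp [hχ, h0, hK3 x h0 hx]]
  refine integral_congr_ae (H.ae_ne_zero.mono fun x hx => ?_)
  have hx' := H.pos x hx
  have hD := ((hv.contDiffAt (isOpen_compl_singleton.mem_nhds hx)).differentiableAt
    one_ne_zero).hasFDerivAt.mul (H.hasFDerivAt_comp_log hx (hη _))
  rw [smul_smul] at hD
  have hgr : gradL σ χ x = _ := (gradL_congr (eqOn_indicator.eventuallyEq_of_mem
    (isOpen_compl_singleton.mem_nhds hx))).trans (gradL_of_hasFDerivAt (σ := σ) hD)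
  have e1 : ‖gradL σ d x‖ ^ p = ‖gradL σ d x‖ ^ (p - 2) * ‖gradL σ d x‖ ^ 2 := by
    rw [← Real.rpow_natCast, ← Real.rpow_add_of_nonneg (norm_nonneg _)
      (sub_nonneg.2 H.two_le) (by norm_num)]
    norm_num
  simp only [hgr, hv0 x hx, smul_zero, add_zero, inner_smul_left, real_inner_self_eq_norm_sq,
    RCLike.conj_to_real, logWeight]
  rw [e1, Real.rpow_sub_one hx'.ne']
  field_simp

/-- A linear functional vanishing on the kernel of `g ↦ ∫ g` is a multiple of it; the multiple is
its value on a bump of integral one. The factor `v` is kept for the radial rigidity argument. -/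
theorem exists_integral_mul_log_eq (H : HardySetting σ d p β)
    (hK : ∀ a b : ℝ, 0 < a → a ≤ b → IsCompact {x : EucN N | x ≠ 0 ∧ a ≤ d x ∧ d x ≤ b})
    {v : EucN N → ℝ} (hv : ContDiffOn ℝ 1 v {0}ᶜ) (hv0 : ∀ x, x ≠ 0 → gradL σ v x = 0) :
    ∃ C : ℝ, ∀ g : ℝ → ℝ, Continuous g → HasCompactSupport g →
      ∫ x, v x * g (Real.log (d x)) * logWeight σ d p β x = C * ∫ t, g t := by
  let b : ContDiffBump (0 : ℝ) := ⟨1, 2, one_pos, one_lt_two⟩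
  have hb : Continuous (b.normed volume) := b.continuous_normed
  have hbc : HasCompactSupport (b.normed volume) := b.hasCompactSupport_normed
  refine ⟨∫ x, v x * b.normed volume (Real.log (d x)) * logWeight σ d p β x, fun g hg hc => ?_⟩
  set I := ∫ t, g t with hI
  have hgi := hg.integrable_of_hasCompactSupport (μ := volume) hc
  have hbi := hb.integrable_of_hasCompactSupport (μ := volume) hbc
  have h0 : ∫ t, (g t - I * b.normed volume t) = 0 := by
    rw [integral_sub hgi (hbi.const_mul I), integral_const_mul, b.integral_normed, mul_one, sub_self]
  have key : ∫ x, v x * (g (Real.log (d x)) - I * b.normed volume (Real.log (d x))) *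
      logWeight σ d p β x = 0 := H.integral_mul_log_eq_zero hK hv hv0 (hg.sub (continuous_const.mul hb))
    (hc.sub hbc.mul_left) h0
  have e : ∀ x, v x * (g (Real.log (d x)) - I * b.normed volume (Real.log (d x))) *
      logWeight σ d p β x = v x * g (Real.log (d x)) * logWeight σ d p β x -
      I * (v x * b.normed volume (Real.log (d x)) * logWeight σ d p β x) := fun x => by ring
  simp_rw [e] at key
  rw [integral_sub (H.integrable_mul_log hK hv.continuousOn hg hc)
    ((H.integrable_mul_log hK hv.continuousOn hb hbc).const_mul I), integral_const_mul] at key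
  linarith

/-- The weighted measure is carried by `log d` to a multiple of Lebesgue measure: this follows from
the equation for `d` and the compactness of its level sets, without the coarea formula. -/
theorem exists_integral_log_eq (H : HardySetting σ d p β)
    (hK : ∀ a b : ℝ, 0 < a → a ≤ b → IsCompact {x : EucN N | x ≠ 0 ∧ a ≤ d x ∧ d x ≤ b}) :
    ∃ C : ℝ, ∀ g : ℝ → ℝ, Continuous g → HasCompactSupport g →
      ∫ x, g (Real.log (d x)) * logWeight σ d p β x = C * ∫ t, g t := by
  obtain ⟨C, hC⟩ := H.exists_integral_mul_log_eq hK (v := fun _ => 1) contDiffOn_const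
    fun x _ => gradL_eq_zero_of_fderiv (by rw [fderiv_fun_const]; rfl)
  exact ⟨C, fun g hg hc => by simpa using hC g hg hc⟩

/-- A `C^1` function of `d` annihilated by `∇_L` is constant. -/
theorem eq_of_gradL_eq_zero_of_radial (H : HardySetting σ d p β)
    (hK : ∀ a b : ℝ, 0 < a → a ≤ b → IsCompact {x : EucN N | x ≠ 0 ∧ a ≤ d x ∧ d x ≤ b})
    {v : EucN N → ℝ} (hv : ContDiffOn ℝ 1 v {0}ᶜ) (hv0 : ∀ x, x ≠ 0 → gradL σ v x = 0)
    (hr : ∀ x y, x ≠ 0 → y ≠ 0 → d x = d y → v x = v y) :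
    ∃ k : ℝ, ∀ x, x ≠ 0 → v x = k := by
  have := H.nontrivial
  obtain ⟨x₀, hx₀⟩ := exists_ne (0 : EucN N)
  refine ⟨v x₀, fun x hx => ?_⟩
  -- The square is nonnegative and still annihilated by `∇_L`, so its weighted integrals against
  -- `g(log d)` are `D ∫ g`; it suffices to show `D = 0`.
  set w : EucN N → ℝ := fun x => (v x - v x₀) ^ 2 with hw
  have hw1 : ContDiffOn ℝ 1 w {0}ᶜ := (hv.sub contDiffOn_const).pow 2
  have hw0 : ∀ x, x ≠ 0 → gradL σ w x = 0 := fun x hx => by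
    have hD := (((hv.contDiffAt (isOpen_compl_singleton.mem_nhds hx)).differentiableAt
      one_ne_zero).hasFDerivAt.sub_const (v x₀)).pow 2
    have hD' : HasFDerivAt w ((2 * (v x - v x₀)) • fderiv ℝ v x + (0 : ℝ) • fderiv ℝ v x) x :=
      hD.congr_fderiv (by ext; simp)
    rw [gradL_of_hasFDerivAt hD', hv0 x hx]
    simp
  have hm : ∀ x, x ≠ 0 → 0 ≤ logWeight σ d p β x := fun x hx => by
    have := Real.rpow_pos_of_pos (H.pos x hx) (-((p - 1) * (1 - β)) - 1)
    rw [logWeight]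
    positivity
  obtain ⟨C, hC⟩ := H.exists_integral_log_eq hK
  obtain ⟨D, hD⟩ := H.exists_integral_mul_log_eq hK hw1 hw0
  -- The part of a compact shell where `w ≥ δ` is compact and misses the level set of `d` through
  -- `x₀`, where `w = 0` by radiality. So `|log d - log d(x₀)|` has a positive minimum on it, unless
  -- it is empty.
  have hclose : ∀ δ > 0, ∃ ε > 0, ∀ x, x ≠ 0 →
      |Real.log (d x) - Real.log (d x₀)| < ε → w x ≤ δ := by
    intro δ hδ
    have hd0 := H.pos x₀ hx₀
    have hS := hK (Real.exp (Real.log (d x₀) - 1)) (Real.exp (Real.log (d x₀) + 1))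
      (Real.exp_pos _) (Real.exp_le_exp.2 (by linarith))
    set S := {x : EucN N | x ≠ 0 ∧ Real.exp (Real.log (d x₀) - 1) ≤ d x ∧
      d x ≤ Real.exp (Real.log (d x₀) + 1)} with hSdef
    have hS0 : S ⊆ {0}ᶜ := fun x hx => hx.1
    have hS' : IsCompact (S ∩ w ⁻¹' Ici δ) :=
      hS.of_isClosed_subset ((hw1.continuousOn.mono hS0).preimage_isClosed_of_isClosed
        hS.isClosed isClosed_Ici) inter_subset_left
    have hSmem : ∀ x, x ≠ 0 → |Real.log (d x) - Real.log (d x₀)| < 1 → x ∈ S := fun x hx h1 => by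
      rw [abs_lt] at h1
      exact ⟨hx, (Real.le_log_iff_exp_le (H.pos x hx)).1 (by linarith),
        (Real.log_le_iff_le_exp (H.pos x hx)).1 (by linarith)⟩
    rcases (S ∩ w ⁻¹' Ici δ).eq_empty_or_nonempty with he | hne
    · refine ⟨1, one_pos, fun x hx h1 => ?_⟩
      by_contra hlt
      exact (he ▸ (⟨hSmem x hx h1, (not_le.1 hlt).le⟩ : x ∈ S ∩ w ⁻¹' Ici δ) : x ∈ (∅ : Set _))
    · obtain ⟨y, hy, hmin⟩ := hS'.exists_isMinOn hne
        ((((H.contDiffOn_log.continuousOn).sub continuousOn_const).abs).mono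
          (inter_subset_left.trans hS0) :
          ContinuousOn (fun x => |Real.log (d x) - Real.log (d x₀)|) _)
      have hy0 : y ≠ 0 := hS0 hy.1
      refine ⟨min 1 |Real.log (d y) - Real.log (d x₀)|, lt_min one_pos
        (abs_pos.2 (sub_ne_zero.2 fun h => ?_)), fun x hx h1 => ?_⟩
      · have := hr y x₀ hy0 hx₀ (Real.log_injOn_pos (H.pos y hy0) hd0 h)
        have h2 : δ ≤ w y := hy.2
        simp only [hw, this, sub_self] at h2
        norm_num at h2
        linarith
      · by_contra hlt
        have := hmin (⟨hSmem x hx (h1.trans_le (min_le_left _ _)), (not_le.1 hlt).le⟩ :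
          x ∈ S ∩ w ⁻¹' Ici δ)
        exact absurd (h1.trans_le (min_le_right _ _)) (not_lt.2 this)
  -- A bump concentrated near `log d(x₀)` sees only values `w ≤ δ`; comparison with the constant `C`
  -- of the unweighted functional gives `D ≤ δ C`.
  have hDnn : 0 ≤ D ∧ ∀ δ > 0, D ≤ δ * C := by
    have aux : ∀ δ > 0, 0 ≤ D ∧ D ≤ δ * C := by
      intro δ hδ
      obtain ⟨ε, hε, hεw⟩ := hclose δ hδ
      let b : ContDiffBump (Real.log (d x₀)) := ⟨ε / 2, ε, half_pos hε, half_lt_self hε⟩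
      have hb := b.continuous
      have hbc := b.hasCompactSupport
      have hpos : 0 < ∫ t, b t := b.integral_pos
      have h1 : 0 ≤ D * ∫ t, b t := by
        rw [← hD b hb hbc]
        exact integral_nonneg_of_ae (H.ae_ne_zero.mono fun x hx =>
          mul_nonneg (mul_nonneg (sq_nonneg _) b.nonneg) (hm x hx))
      have h2 : D * ∫ t, b t ≤ δ * (C * ∫ t, b t) := by
        rw [← hD b hb hbc, ← hC b hb hbc, ← integral_const_mul]
        have hi : Integrable fun x => b (Real.log (d x)) * logWeight σ d p β x := by
          simpa using H.integrable_mul_log hK (v := fun _ => 1) continuousOn_const hb hbc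
        refine integral_mono_ae (H.integrable_mul_log hK hw1.continuousOn hb hbc)
          (hi.const_mul δ) (H.ae_ne_zero.mono fun x hx => ?_)
        simp only
        rw [mul_assoc]
        by_cases hx1 : |Real.log (d x) - Real.log (d x₀)| < ε
        · exact mul_le_mul_of_nonneg_right (hεw x hx hx1) (mul_nonneg b.nonneg (hm x hx))
        · rw [b.zero_of_le_dist (by rw [Real.dist_eq]; exact not_lt.1 hx1)]
          simp
      refine ⟨nonneg_of_mul_nonneg_left h1 hpos, le_of_mul_le_mul_right ?_ hpos⟩
      rwa [mul_assoc]
    exact ⟨(aux 1 one_pos).1, fun δ hδ => (aux δ hδ).2⟩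
  have hD0 : D = 0 := by
    refine le_antisymm (le_of_forall_pos_le_add fun e he => ?_) hDnn.1
    have := hDnn.2 (e / (|C| + 1)) (by positivity)
    have h2 : e / (|C| + 1) * C ≤ e := by
      rw [div_mul_eq_mul_div, div_le_iff₀ (by positivity)]
      exact mul_le_mul_of_nonneg_left (by linarith [le_abs_self C]) he.le
    linarith
  -- With `D = 0`, bumps equal to `1` on `[-n, n]` exhaust the space.
  have hz : ∀ n : ℕ, ∀ᵐ x, |Real.log (d x)| ≤ n → w x * logWeight σ d p β x = 0 := fun n => by
    let b : ContDiffBump (0 : ℝ) := ⟨n + 1, n + 2, by positivity, by linarith⟩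
    have h1 := hD b b.continuous b.hasCompactSupport
    rw [hD0, zero_mul, integral_eq_zero_iff_of_nonneg_ae (H.ae_ne_zero.mono fun x hx =>
      mul_nonneg (mul_nonneg (sq_nonneg _) b.nonneg) (hm x hx))
      (H.integrable_mul_log hK hw1.continuousOn b.continuous b.hasCompactSupport)] at h1
    filter_upwards [h1] with x hx hxn
    rwa [b.one_of_mem_closedBall, mul_one] at hx
    rw [mem_closedBall_zero_iff, Real.norm_eq_abs]
    show _ ≤ (n : ℝ) + 1
    linarith
  have hae : ∀ᵐ x, w x = 0 := by
    filter_upwards [ae_all_iff.2 hz, H.ae_ne_zero, H.ae_gradL_ne_zero] with x hx hx0 hxg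
    obtain ⟨n, hn⟩ := exists_nat_ge |Real.log (d x)|
    refine (mul_eq_zero.1 (hx n hn)).resolve_right ?_
    exact (mul_pos (Real.rpow_pos_of_pos (H.pos x hx0) _)
      (Real.rpow_pos_of_pos (norm_pos_iff.2 hxg) _)).ne'
  have := eqOn_zero_of_ae hw1.continuousOn hae hx
  exact sub_eq_zero.1 (pow_eq_zero_iff two_ne_zero |>.1 this)

/-! ### Energies of the functions `d ^ α g(log d)`. -/

theorem isTest_logRadial (H : HardySetting σ d p β)
    (hK : ∀ a b : ℝ, 0 < a → a ≤ b → IsCompact {x : EucN N | x ≠ 0 ∧ a ≤ d x ∧ d x ≤ b})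
    (a : ℝ) {g : ℝ → ℝ} (hg : ContDiff ℝ ∞ g) (hc : HasCompactSupport g) :
    IsTest (logRadial d a g) := by
  obtain ⟨K, hK1, hK2, hK3⟩ := H.exists_isCompact_log hK hc
  have h1 : ContDiffOn ℝ ∞ (logRadial d a g) {0}ᶜ :=
    ((H.contDiffOn_rpow a).mul (hg.comp_contDiffOn H.contDiffOn_log)).congr
      fun x hx => indicator_of_mem hx _
  exact h1.contDiff_of_support_subset isOpen_compl_singleton hK1 hK2 fun x hx => by
    by_cases h0 : x = 0
    · simp [logRadial, h0]
    · simp [logRadial, h0, hK3 x h0 hx]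

theorem massDensity_logRadial (H : HardySetting σ d p β) (θ : ℝ) (g : ℝ → ℝ) {x : EucN N}
    (hx : x ≠ 0) : massDensity σ d p θ (logRadial d (hardyExp p β θ) g) x =
      |g (Real.log (d x))| ^ p * logWeight σ d p β x := by
  have hx' := H.pos x hx
  rw [massDensity, logRadial, indicator_of_mem (show x ∈ ({0}ᶜ : Set _) from hx), abs_mul,
    Real.mul_rpow (abs_nonneg _) (abs_nonneg _), abs_of_pos (Real.rpow_pos_of_pos hx' _),
    ← Real.rpow_mul hx'.le, logWeight, mul_comm (hardyExp p β θ), H.mul_hardyExp,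
    show p * θ - 1 - (p - 1) * (1 - β) = p * θ + (-((p - 1) * (1 - β)) - 1) by ring,
    Real.rpow_add hx']
  have := Real.rpow_pos_of_pos hx' (p * θ)
  field_simp

theorem gradL_logRadial (H : HardySetting σ d p β) (a : ℝ) {g : ℝ → ℝ}
    (hg : Differentiable ℝ g) {x : EucN N} (hx : x ≠ 0) :
    gradL σ (logRadial d a g) x =
      (d x ^ (a - 1) * (a * g (Real.log (d x)) + deriv g (Real.log (d x)))) • gradL σ d x := by
  have hx' := H.pos x hx
  have hD := (H.hasFDerivAt_rpow a hx).mul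
    (H.hasFDerivAt_comp_log hx (hg (Real.log (d x))).hasDerivAt)
  rw [smul_smul, smul_smul] at hD
  refine (gradL_congr (eqOn_indicator.eventuallyEq_of_mem
    (isOpen_compl_singleton.mem_nhds hx))).trans ((gradL_of_hasFDerivAt (σ := σ) hD).trans ?_)
  rw [← add_smul, Real.rpow_sub_one hx'.ne']
  congr 1
  field_simp
  ring

theorem gradientDensity_logRadial (H : HardySetting σ d p β) (θ : ℝ) {g : ℝ → ℝ}
    (hg : Differentiable ℝ g) {x : EucN N} (hx : x ≠ 0) :
    gradientDensity σ d p θ (logRadial d (hardyExp p β θ) g) x =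
      |hardyExp p β θ * g (Real.log (d x)) + deriv g (Real.log (d x))| ^ p *
        logWeight σ d p β x := by
  have hx' := H.pos x hx
  have hd := Real.rpow_pos_of_pos hx' (p * (θ - 1))
  rw [gradientDensity, H.gradL_logRadial _ hg hx, norm_smul, Real.norm_eq_abs, abs_mul,
    abs_of_pos (Real.rpow_pos_of_pos hx' _), Real.mul_rpow (by positivity) (norm_nonneg _),
    Real.mul_rpow (by positivity) (abs_nonneg _), ← Real.rpow_mul hx'.le, logWeight,
    show (hardyExp p β θ - 1) * p = p * (θ - 1) + (-((p - 1) * (1 - β)) - 1) by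
      linarith [H.mul_hardyExp θ], Real.rpow_add hx']
  field_simp

/-- The gradient of a function of `d` is parallel to `∇_L d`, so Cauchy–Schwarz is an equality. -/
theorem radialDensity_logRadial (H : HardySetting σ d p β) (θ a : ℝ) {g : ℝ → ℝ}
    (hg : Differentiable ℝ g) {x : EucN N} (hx : x ≠ 0) :
    radialDensity σ d p θ (logRadial d a g) x = gradientDensity σ d p θ (logRadial d a g) x := by
  have hp0 : p ≠ 0 := by linarith [H.two_le]
  rw [radialDensity, gradientDensity, H.gradL_logRadial _ hg hx, inner_smul_left,
    real_inner_self_eq_norm_sq, norm_smul, RCLike.conj_to_real, abs_mul, abs_pow, abs_norm,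
    Real.norm_eq_abs, sq, ← mul_assoc, Real.mul_rpow (by positivity) (norm_nonneg _)]
  rcases eq_or_ne (gradL σ d x) 0 with h0 | h0
  · simp [h0, Real.zero_rpow hp0]
  · have := Real.rpow_pos_of_pos (norm_pos_iff.2 h0) p
    field_simp

theorem radialInt_logRadial (H : HardySetting σ d p β) (θ a : ℝ) {g : ℝ → ℝ}
    (hg : Differentiable ℝ g) :
    radialInt σ d p θ (logRadial d a g) = gradientInt σ d p θ (logRadial d a g) :=
  integral_congr_ae (H.ae_ne_zero.mono fun _ hx => H.radialDensity_logRadial θ a hg hx)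

/-- The energies of `d ^ α ψ(log d / r)` are those of `ψ` on the line, up to a constant. -/
theorem exists_energies_logRadial (H : HardySetting σ d p β)
    (hK : ∀ a b : ℝ, 0 < a → a ≤ b → IsCompact {x : EucN N | x ≠ 0 ∧ a ≤ d x ∧ d x ≤ b})
    (θ : ℝ) :
    ∃ C : ℝ, ∀ ψ : ℝ → ℝ, ContDiff ℝ ∞ ψ → HasCompactSupport ψ → ∀ r : ℝ, 0 < r →
      IsTest (logRadial d (hardyExp p β θ) fun t => ψ (t / r)) ∧
      massInt σ d p θ (logRadial d (hardyExp p β θ) fun t => ψ (t / r)) =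
        C * r * ∫ t, |ψ t| ^ p ∧
      gradientInt σ d p θ (logRadial d (hardyExp p β θ) fun t => ψ (t / r)) =
        C * r * ∫ t, |hardyExp p β θ * ψ t + 1 / r * deriv ψ t| ^ p ∧
      radialInt σ d p θ (logRadial d (hardyExp p β θ) fun t => ψ (t / r)) =
        gradientInt σ d p θ (logRadial d (hardyExp p β θ) fun t => ψ (t / r)) := by
  obtain ⟨C, hC⟩ := H.exists_integral_log_eq hK
  refine ⟨C, fun ψ hψ hψc r hr => ?_⟩
  have hp0 : 0 < p := by linarith [H.two_le]
  set α := hardyExp p β θ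
  set g : ℝ → ℝ := fun t => ψ (t / r) with hg
  have hg1 : ContDiff ℝ ∞ g := hψ.comp (contDiff_id.div_const r)
  have hgc : HasCompactSupport g := by
    have := hψc.comp_homeomorph (Homeomorph.mulRight₀ r⁻¹ (inv_ne_zero hr.ne'))
    simpa [Function.comp_def, hg, div_eq_mul_inv] using this
  have hgd : Differentiable ℝ g := hg1.differentiable (by simp)
  have hg' : ∀ t, deriv g t = 1 / r * deriv ψ (t / r) := fun t => by
    have h1 := ((hψ.differentiable (by simp) (t / r)).hasDerivAt).comp t
      ((hasDerivAt_id t).div_const r)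
    rw [show deriv g t = _ from h1.deriv]
    ring
  have hdc : Continuous (deriv g) := hg1.continuous_deriv (by simp)
  have hzero : ∀ t, t ∉ tsupport g → g t = 0 ∧ deriv g t = 0 := fun t ht =>
    ⟨image_eq_zero_of_notMem_tsupport ht,
      Function.notMem_support.1 fun h => ht (support_deriv_subset h)⟩
  refine ⟨H.isTest_logRadial hK _ hg1 hgc, ?_, ?_, H.radialInt_logRadial θ _ hgd⟩
  · rw [massInt, integral_congr_ae (H.ae_ne_zero.mono fun x hx =>
      H.massDensity_logRadial θ g hx), hC (fun t => |g t| ^ p)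
      (hg1.continuous.abs.rpow_const fun _ => .inr hp0.le)
      (HasCompactSupport.intro hgc fun t ht => by
        simp [hzero t ht, Real.zero_rpow hp0.ne']),
      Measure.integral_comp_div (fun t => |ψ t| ^ p) r, abs_of_pos hr, smul_eq_mul, mul_assoc]
  · rw [gradientInt, integral_congr_ae (H.ae_ne_zero.mono fun x hx =>
      H.gradientDensity_logRadial θ hgd hx), hC (fun t => |α * g t + deriv g t| ^ p)
      ((by fun_prop : Continuous fun t => |α * g t + deriv g t|).rpow_const
        fun _ => .inr hp0.le)
      (HasCompactSupport.intro hgc fun t ht => by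
        simp [hzero t ht, Real.zero_rpow hp0.ne'])]
    simp_rw [hg', hg]
    rw [Measure.integral_comp_div (fun t => |α * ψ t + 1 / r * deriv ψ t| ^ p) r, abs_of_pos hr,
      smul_eq_mul, mul_assoc]

end HardySetting

/-! ### Extremals and sharpness of the constant. -/

namespace HardySetting

variable {N h : ℕ} {σ : EucN N → Matrix (Fin h) (Fin N) ℝ} {d : EucN N → ℝ} {p β : ℝ}

/-- The constant sequence does it; exact extremals thus fall under the rigidity result. -/
theorem achievesBoth_of_eq {θ : ℝ} {u : EucN N → ℝ} (hu : IsTest u)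
    (h1 : |hardyExp p β θ| ^ p * massInt σ d p θ u = radialInt σ d p θ u)
    (h2 : radialInt σ d p θ u = gradientInt σ d p θ u) : AchievesBoth σ d p β θ u := by
  refine ⟨hu.contDiff_one.contDiffOn, fun _ => u, fun _ => hu, ?_, ?_, ?_, ?_⟩
  · exact fun s hs x _ => ⟨univ, univ_mem, .of_forall fun _ y _ => refl_mem_uniformity hs⟩
  · exact fun s hs x _ => ⟨univ, univ_mem, .of_forall fun _ y _ => refl_mem_uniformity hs⟩
  · simp [h1]
  · simp [h2]

/-- The Hardy inequality itself serves as a unique continuation principle: with a nonzero constant,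
zero radial energy forces zero mass. -/
theorem eq_zero_of_gradL_eq_zero (H : HardySetting σ d p β) {v : EucN N → ℝ} (hv : IsTest v)
    (hv0 : ∀ x, x ≠ 0 → gradL σ v x = 0) : v = 0 := by
  have hp0 : 0 < p := by linarith [H.two_le]
  by_contra hne
  -- This weight is chosen to make the Hardy exponent equal to `1`.
  set θ : ℝ := 2 - β * (p - 1) / p with hθ
  have h1 : hardyExp p β θ = 1 := by
    rw [hardyExp, hθ]; field_simp; ring
  have h2 := H.massInt_le_radialInt θ hv
  have h3 : radialInt σ d p θ v = 0 := integral_eq_zero_of_ae (H.ae_ne_zero.mono fun x hx => by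
    simp [radialDensity, hv0 x hx, Real.zero_rpow hp0.ne'])
  rw [h1, h3, abs_one, Real.one_rpow, one_mul] at h2
  exact absurd (H.massInt_pos θ hv hne) (not_lt.2 h2)

/-- No nonzero test function attains equality throughout. -/
theorem eq_zero_of_equality (H : HardySetting σ d p β) {θ : ℝ} {u : EucN N → ℝ} (hu : IsTest u)
    (h1 : |hardyExp p β θ| ^ p * massInt σ d p θ u = radialInt σ d p θ u)
    (h2 : radialInt σ d p θ u = gradientInt σ d p θ u) : u = 0 := by
  set v : EucN N → ℝ := fun y => d y ^ (-hardyExp p β θ) * u y with hv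
  have hvt : IsTest v :=
    ((H.contDiffOn_rpow _).mul hu.1.contDiffOn).contDiff_of_support_subset
      isOpen_compl_singleton hu.2.1.isCompact hu.2.2 fun x hx => by
        simp [image_eq_zero_of_notMem_tsupport hx]
  have := H.eq_zero_of_gradL_eq_zero hvt fun x hx =>
    H.gradL_eq_zero_of_achievesBoth (achievesBoth_of_eq hu h1 h2) hx
  funext x
  rcases eq_or_ne x 0 with rfl | hx
  · exact hu.apply_zero
  · exact (mul_eq_zero.1 (congrFun this x)).resolve_left (Real.rpow_pos_of_pos (H.pos x hx) _).ne'

/-- Multiples of `d ^ α` attain both equalities. -/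
theorem achievesBoth_const_mul_rpow (H : HardySetting σ d p β)
    (hK : ∀ a b : ℝ, 0 < a → a ≤ b → IsCompact {x : EucN N | x ≠ 0 ∧ a ≤ d x ∧ d x ≤ b})
    (θ c : ℝ) : AchievesBoth σ d p β θ fun x => c * d x ^ hardyExp p β θ := by
  obtain ⟨C, hC⟩ := H.exists_energies_logRadial hK θ
  set α := hardyExp p β θ with hα
  let b : ContDiffBump (0 : ℝ) := ⟨1, 2, one_pos, one_lt_two⟩
  set ψ : ℝ → ℝ := fun t => c * b t with hψ
  have hψ1 : ContDiff ℝ ∞ ψ := contDiff_const.mul b.contDiff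
  have hψc : HasCompactSupport ψ := b.hasCompactSupport.mul_left
  have hr : ∀ n : ℕ, 0 < (n : ℝ) + 1 := fun n => by positivity
  set U : ℕ → EucN N → ℝ := fun n => logRadial d α fun t => ψ (t / ((n : ℝ) + 1)) with hU
  have hE := fun n => hC ψ hψ1 hψc _ (hr n)
  -- The cut-off `b(log d / (n + 1))` is `1` where `|log d| ≤ n + 1`. So near each point `U n`
  -- eventually coincides with the limit on an open set, and the convergence of functions and
  -- derivatives is immediate.
  have hloc : ∀ x, x ≠ 0 → ∃ O ∈ 𝓝 x, IsOpen O ∧ ∀ᶠ n in atTop, ∀ y ∈ O,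
      U n y = c * d y ^ α := by
    intro x hx
    refine ⟨{0}ᶜ ∩ (fun y => |Real.log (d y)|) ⁻¹' Iio (|Real.log (d x)| + 1), ?_,
      H.contDiffOn_log.continuousOn.abs.isOpen_inter_preimage isOpen_compl_singleton isOpen_Iio, ?_⟩
    · exact (H.contDiffOn_log.continuousOn.abs.isOpen_inter_preimage isOpen_compl_singleton
        isOpen_Iio).mem_nhds ⟨hx, by simp⟩
    · obtain ⟨n₀, hn₀⟩ := exists_nat_ge (|Real.log (d x)| + 1)
      filter_upwards [eventually_ge_atTop n₀] with n hn y hy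
      have h1 : |Real.log (d y)| < |Real.log (d x)| + 1 := hy.2
      have h2 : (n₀ : ℝ) ≤ n := by exact_mod_cast hn
      have h3 : b (Real.log (d y) / ((n : ℝ) + 1)) = 1 := by
        refine b.one_of_mem_closedBall ?_
        rw [mem_closedBall_zero_iff, Real.norm_eq_abs, abs_div, abs_of_pos (hr n)]
        show _ ≤ (1 : ℝ)
        rw [div_le_one (hr n)]
        linarith
      simp only [hU, logRadial, indicator_of_mem hy.1, hψ, h3]
      ring
  -- This is the difference quotient at `0`, with step `1 / (n + 1)`, of the stationary energy on
  -- the line: the growing factor `n + 1` in the energies is exactly the inverse step.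
  have hslope : Tendsto (fun n : ℕ => ((n : ℝ) + 1) *
      ((∫ t, |α * ψ t + 1 / ((n : ℝ) + 1) * deriv ψ t| ^ p) - |α| ^ p * ∫ t, |ψ t| ^ p))
      atTop (𝓝 0) := by
    have h1 := (hasDerivAt_integral_abs_rpow H.two_le α (hψ1.of_le (by exact_mod_cast le_top))
      hψc).tendsto_slope_zero
    have h2 : Tendsto (fun n : ℕ => 1 / ((n : ℝ) + 1)) atTop (𝓝[≠] 0) :=
      tendsto_nhdsWithin_iff.2 ⟨tendsto_one_div_add_atTop_nhds_zero_nat,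
        .of_forall fun n => (one_div_pos.2 (hr n)).ne'⟩
    refine (h1.comp h2).congr fun n => ?_
    simp only [Function.comp_apply, zero_add, zero_mul, add_zero, smul_eq_mul, one_div, inv_inv,
      abs_mul, Real.mul_rpow (abs_nonneg α) (abs_nonneg _), integral_const_mul]
  refine ⟨contDiffOn_const.mul ((H.contDiffOn_rpow _).of_le (by exact_mod_cast le_top)), U,
    fun n => (hE n).1, ?_, ?_, ?_, ?_⟩
  · intro s hs x hx
    obtain ⟨O, hO, -, hOe⟩ := hloc x hx
    refine ⟨O, mem_nhdsWithin_of_mem_nhds hO, hOe.mono fun n hn y hy => ?_⟩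
    rw [hn y hy]
    exact refl_mem_uniformity hs
  · intro s hs x hx
    obtain ⟨O, hO, hOo, hOe⟩ := hloc x hx
    refine ⟨O, mem_nhdsWithin_of_mem_nhds hO, hOe.mono fun n hn y hy => ?_⟩
    have : U n =ᶠ[𝓝 y] fun x => c * d x ^ α := by
      filter_upwards [hOo.mem_nhds hy] with z hz using hn z hz
    beta_reduce
    rw [this.fderiv_eq]
    exact refl_mem_uniformity hs
  · have := hslope.const_mul C
    rw [mul_zero] at this
    refine this.congr fun n => ?_
    rw [(hE n).2.2.2, (hE n).2.2.1, (hE n).2.1]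
    ring
  · refine tendsto_const_nhds.congr fun n => ?_
    rw [(hE n).2.2.2, sub_self]

/-- The quotients of both energies by the mass come arbitrarily close to `|α| ^ p`. -/
theorem exists_tendsto_quotient (H : HardySetting σ d p β)
    (hK : ∀ a b : ℝ, 0 < a → a ≤ b → IsCompact {x : EucN N | x ≠ 0 ∧ a ≤ d x ∧ d x ≤ b})
    (θ : ℝ) : ∃ U : ℕ → EucN N → ℝ, (∀ n, IsTest (U n)) ∧ (∀ᶠ n in atTop, U n ≠ 0) ∧
      (∀ n, radialInt σ d p θ (U n) = gradientInt σ d p θ (U n)) ∧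
      Tendsto (fun n => gradientInt σ d p θ (U n) / massInt σ d p θ (U n)) atTop
        (𝓝 (|hardyExp p β θ| ^ p)) := by
  obtain ⟨C, hC⟩ := H.exists_energies_logRadial hK θ
  set α := hardyExp p β θ with hα
  let b : ContDiffBump (0 : ℝ) := ⟨1, 2, one_pos, one_lt_two⟩
  have hr : ∀ n : ℕ, 0 < (n : ℝ) + 1 := fun n => by positivity
  set U : ℕ → EucN N → ℝ := fun n => logRadial d α fun t => b (t / ((n : ℝ) + 1)) with hU
  have hE := fun n => hC b b.contDiff b.hasCompactSupport _ (hr n)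
  have hU0 : ∀ᶠ n in atTop, U n ≠ 0 := by
    have := H.nontrivial
    obtain ⟨x, hx⟩ := exists_ne (0 : EucN N)
    obtain ⟨n₀, hn₀⟩ := exists_nat_ge |Real.log (d x)|
    filter_upwards [eventually_ge_atTop n₀] with n hn h0
    have h2 : (n₀ : ℝ) ≤ n := by exact_mod_cast hn
    have h3 : b (Real.log (d x) / ((n : ℝ) + 1)) = 1 := by
      refine b.one_of_mem_closedBall ?_
      rw [mem_closedBall_zero_iff, Real.norm_eq_abs, abs_div, abs_of_pos (hr n)]
      show _ ≤ (1 : ℝ)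
      rw [div_le_one (hr n)]
      linarith
    have h4 := congrFun h0 x
    simp only [hU, logRadial, indicator_of_mem (show x ∈ ({0}ᶜ : Set _) from hx), h3, mul_one,
      Pi.zero_apply] at h4
    exact (Real.rpow_pos_of_pos (H.pos x hx) _).ne' h4
  refine ⟨U, fun n => (hE n).1, hU0, fun n => (hE n).2.2.2, ?_⟩
  -- Positivity of the mass of `U n` supplies the nonvanishing of both `C` and `∫ |b| ^ p`.
  have hM : ∀ᶠ n : ℕ in atTop, 0 < C * ((n : ℝ) + 1) * ∫ t, |b t| ^ p := hU0.mono fun n hn => by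
    rw [← (hE n).2.1]
    exact H.massInt_pos θ (hE n).1 hn
  obtain ⟨n, hn⟩ := hM.exists
  have hB : (∫ t, |b t| ^ p) ≠ 0 := right_ne_zero_of_mul hn.ne'
  have hlim : Tendsto (fun n : ℕ => (∫ t, |α * b t + 1 / ((n : ℝ) + 1) * deriv b t| ^ p) /
      ∫ t, |b t| ^ p) atTop (𝓝 (|α| ^ p)) := by
    have h1 := ((hasDerivAt_integral_abs_rpow H.two_le α b.contDiff
      b.hasCompactSupport).continuousAt.tendsto.comp
      tendsto_one_div_add_atTop_nhds_zero_nat).div_const (∫ t, |b t| ^ p)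
    simp only [zero_mul, add_zero, abs_mul, Real.mul_rpow (abs_nonneg α) (abs_nonneg _),
      integral_const_mul, mul_div_cancel_right₀ _ hB] at h1
    exact h1
  refine hlim.congr' (hM.mono fun n hn => ?_)
  simp only [hU]
  rw [(hE n).2.1, (hE n).2.2.1, mul_div_mul_left _ _ (left_ne_zero_of_mul hn.ne')]

theorem isGLB_of_quotient {E : (EucN N → ℝ) → ℝ} (H : HardySetting σ d p β) (θ : ℝ)
    (hle : ∀ u, IsTest u → |hardyExp p β θ| ^ p * massInt σ d p θ u ≤ E u)
    (hE : ∃ U : ℕ → EucN N → ℝ, (∀ n, IsTest (U n)) ∧ (∀ᶠ n in atTop, U n ≠ 0) ∧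
      Tendsto (fun n => E (U n) / massInt σ d p θ (U n)) atTop (𝓝 (|hardyExp p β θ| ^ p))) :
    IsGLB {q : ℝ | ∃ u : EucN N → ℝ, IsTest u ∧ u ≠ 0 ∧ q = E u / massInt σ d p θ u}
      (|hardyExp p β θ| ^ p) := by
  obtain ⟨U, hU, hU0, hlim⟩ := hE
  refine ⟨?_, fun m hm => ge_of_tendsto hlim (hU0.mono fun n hn => hm ⟨U n, hU n, hn, rfl⟩)⟩
  rintro q ⟨u, hu, hu0, rfl⟩
  rw [le_div_iff₀ (H.massInt_pos θ hu hu0)]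
  exact hle u hu

theorem eq_const_mul_rpow (H : HardySetting σ d p β) {a k : ℝ} {u : EucN N → ℝ}
    (hk : ∀ x, x ≠ 0 → d x ^ (-a) * u x = k) {x : EucN N} (hx : x ≠ 0) :
    u x = k * d x ^ a := by
  have := Real.rpow_pos_of_pos (H.pos x hx) a
  rw [← hk x hx, Real.rpow_neg (H.pos x hx).le]
  field_simp

end HardySetting

/-! ### The main theorem. -/

theorem theorem1p1 (N h : ℕ) (_hhN : h ≤ N)
    (σ : EucN N → Matrix (Fin h) (Fin N) ℝ)
    (hσ : ∀ i j, ContDiffOn ℝ 1 (fun x => σ x i j) {0}ᶜ)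
    (d : EucN N → ℝ)
    (hd : ContDiffOn ℝ ∞ d {0}ᶜ)
    (hdpos : ∀ x, x ≠ 0 → 0 < d x)
    (hdL : ∀ᵐ x : EucN N, gradL σ d x ≠ 0)
    (hdreg : ∀ᵐ r : ℝ, 0 < r → ∀ x, x ≠ 0 → d x = r → ∇ d x ≠ 0)
    (p β : ℝ) (hp : 2 ≤ p)
    (hLp : ∀ x, x ≠ 0 → opLp σ p d x = (1 - β) * (p - 1) * ‖gradL σ d x‖ ^ p / d x) :
    -- the inequalities, between finite integrals
    (∀ θ : ℝ, ∀ u : EucN N → ℝ, IsTest u →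
      Integrable (massDensity σ d p θ u) ∧
      Integrable (radialDensity σ d p θ u) ∧
      Integrable (gradientDensity σ d p θ u) ∧
      |(p * (θ - 1) + β * (p - 1)) / p| ^ p * massInt σ d p θ u ≤ radialInt σ d p θ u ∧
      radialInt σ d p θ u ≤ gradientInt σ d p θ u) ∧
    -- sharpness and extremals
    (∀ γ : ℝ, 0 < γ →
      (∀ᵐ r : ℝ, 0 < r →
        ∫⁻ x in {x : EucN N | x ≠ 0 ∧ d x = r},
            ENNReal.ofReal (‖gradL σ d x‖ ^ p / ‖∇ d x‖) ∂(μH[(N : ℝ) - 1])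
          = ENNReal.ofReal (γ * r ^ ((p - 1) * (1 - β)))) →
      (∀ a b : ℝ, 0 < a → a ≤ b → IsCompact {x : EucN N | x ≠ 0 ∧ a ≤ d x ∧ d x ≤ b}) →
      ∀ θ : ℝ,
        -- the constant is the infimum of both quotients
        IsGLB {q : ℝ | ∃ u : EucN N → ℝ, IsTest u ∧ u ≠ 0 ∧
            q = radialInt σ d p θ u / massInt σ d p θ u}
          (|(p * (θ - 1) + β * (p - 1)) / p| ^ p) ∧
        IsGLB {q : ℝ | ∃ u : EucN N → ℝ, IsTest u ∧ u ≠ 0 ∧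
            q = gradientInt σ d p θ u / massInt σ d p θ u}
          (|(p * (θ - 1) + β * (p - 1)) / p| ^ p) ∧
        -- no admissible function other than zero achieves both equalities
        (∀ u : EucN N → ℝ, IsTest u → u ≠ 0 →
          ¬ (|(p * (θ - 1) + β * (p - 1)) / p| ^ p * massInt σ d p θ u = radialInt σ d p θ u ∧
            radialInt σ d p θ u = gradientInt σ d p θ u)) ∧
        -- the multiples of `d ^ α` achieve both equalities
        (∀ c : ℝ, AchievesBoth σ d p β θ
          (fun x => c * d x ^ ((p * (θ - 1) + β * (p - 1)) / p))) ∧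
        -- and they are the only ones, up to factors that `∇_L` cannot see
        (∀ u : EucN N → ℝ, AchievesBoth σ d p β θ u →
          (∀ x, x ≠ 0 →
            gradL σ (fun y => d y ^ (-((p * (θ - 1) + β * (p - 1)) / p)) * u y) x = 0) ∧
          ((∃ φ : ℝ → ℝ, ∀ x, x ≠ 0 → u x = φ (d x)) →
            ∃ c : ℝ, ∀ x, x ≠ 0 → u x = c * d x ^ ((p * (θ - 1) + β * (p - 1)) / p)) ∧
          ((∀ v : EucN N → ℝ, ContDiffOn ℝ 1 v {0}ᶜ → (∀ x, x ≠ 0 → gradL σ v x = 0) →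
              ∃ c : ℝ, ∀ x, x ≠ 0 → v x = c) →
            ∃ c : ℝ, ∀ x, x ≠ 0 → u x = c * d x ^ ((p * (θ - 1) + β * (p - 1)) / p)))) := by
  have H : HardySetting σ d p β := ⟨hσ, hd, hdpos, hdL, hp, hLp, _hhN⟩
  refine ⟨fun θ u hu => ⟨H.integrable_massDensity θ hu, H.integrable_radialDensity θ hu,
    H.integrable_gradientDensity θ hu, H.massInt_le_radialInt θ hu,
    H.radialInt_le_gradientInt θ hu⟩, fun γ _ _ hK θ => ?_⟩
  -- One sequence serves both infima, because its radial and full energies agree.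
  obtain ⟨U, hU, hU0, hRG, hlim⟩ := H.exists_tendsto_quotient hK θ
  refine ⟨H.isGLB_of_quotient θ (fun u hu => H.massInt_le_radialInt θ hu)
      ⟨U, hU, hU0, by simpa only [hRG] using hlim⟩,
    H.isGLB_of_quotient θ (fun u hu => (H.massInt_le_radialInt θ hu).trans
      (H.radialInt_le_gradientInt θ hu)) ⟨U, hU, hU0, hlim⟩,
    fun u hu hu0 h => hu0 (H.eq_zero_of_equality hu h.1 h.2),
    H.achievesBoth_const_mul_rpow hK θ, fun u hu => ?_⟩
  have hv : ContDiffOn ℝ 1 (fun y => d y ^ (-hardyExp p β θ) * u y) {0}ᶜ :=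
    ((H.contDiffOn_rpow _).of_le (by exact_mod_cast le_top)).mul hu.1
  have hv0 : ∀ x, x ≠ 0 → gradL σ (fun y => d y ^ (-hardyExp p β θ) * u y) x = 0 :=
    fun x hx => H.gradL_eq_zero_of_achievesBoth hu hx
  refine ⟨hv0, fun ⟨φ, hφ⟩ => ?_, fun hconst => ?_⟩
  · obtain ⟨k, hk⟩ := H.eq_of_gradL_eq_zero_of_radial hK hv hv0 fun x y hx hy hxy => by
      rw [hφ x hx, hφ y hy, hxy]
    exact ⟨k, fun x hx => H.eq_const_mul_rpow hk hx⟩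
  · obtain ⟨k, hk⟩ := hconst _ hv hv0
    exact ⟨k, fun x hx => H.eq_const_mul_rpow hk hx⟩
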